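/- All curves are continuous maps $\gamma:[a,b]\to X$ on compact intervals, $\ell(\gamma)$ denotes the length of $\gamma$ (the supremum, over partitions of $[a,b]$, of the sums of distances between consecutive points), and $\gamma$ is rectifiable if $\ell(\gamma)<\infty$. A metric space $(X,d)$ is quasiconvex if there is a constant $C_q\ge 1$ such that any $x,y\in X$ can be connected by a rectifiable curve $\gamma:[0,1]\to X$, $\gamma(0)=x$, $\gamma(1)=y$, with $\ell(\gamma)\le C_q\,d(x,y)$. A mapping $\Phi:X\to Y$ between metric spaces is weak BLD (of weak bounded length distortion) if there is a constant $M\ge 1$ such that $M^{-1}\ell(\gamma)\le \ell(\Phi\circ\gamma)\le M\,\ell(\gamma)$ for all rectifiable curves $\gamma$ in $X$. A function $u:E\to\mathbb R$, $E\subset\mathbb R^k$ measurable, is approximately differentiable at $x\in E$ with approximate derivative $\operatorname{ap}Du(x)=v\in\mathbb R^k$ if there is a measurable set $S\subset E$ having $x$ as a density point such that $\frac{u(y)-u(x)-\langle v,y-x\rangle}{|y-x|}\to 0$ as $y\to x$, $y\in S\setminus\{x\}$. For $g=(g_1,g_2,\dots):E\to\ell^\infty$, the approximate derivative $\operatorname{ap}Dg(x)$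 is the $\infty\times k$ matrix whose $i$-th row is $\operatorname{ap}Dg_i(x)$; it is defined when every $g_i$ is approximately differentiable at $x$ (for Lipschitz $g$, this is the case for almost every $x\in E$). **Theorem.** Let $(X,d)$ be a complete and quasiconvex metric space and let $\Phi:X\to\ell^\infty$ be a weak BLD mapping, where $\ell^\infty$ is the space of bounded real sequences with the supremum norm. Then, for any $k\in\mathbb N$ and any Lipschitz map $f:E\to X$ defined on a (Lebesgue) measurable set $E\subset\mathbb R^k$, the following conditions are equivalent, where $\mathcal H^k$ denotes the $k$-dimensional Hausdorff measure: 1. $\mathcal H^k(f(E))=0$ in $X$; 2. $\mathcal H^k(\Phi(f(E)))=0$ in $\ell^\infty$; 3. for almost every $x\in E$, $\operatorname{ap}D(\Phi\circ f)(x)$ is defined and $\operatorname{rank}\bigl(\operatorname{ap}D(\Phi\circ f)(x)\bigr)<k$. -/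

import Mathlib

open MeasureTheory Filter Topology Set
open scoped ENNReal NNReal MeasureTheory

/-- The Banach space `ℓ^∞` of bounded real sequences with the supremum norm. -/
abbrev EllInfty : Type := lp (fun _ : ℕ => ℝ) ∞

/-- `ℓ^∞` carries the Borel σ-algebra of its norm topology. -/
noncomputable instance EllInfty.instMeasurableSpace : MeasurableSpace EllInfty := borel EllInfty

instance EllInfty.instBorelSpace : BorelSpace EllInfty := ⟨rfl⟩

/-- The length of a curve `γ : [a, b] → X` is the supremum, over all partitions of `[a, b]`, of the
sums of the distances between consecutive points (only the values of `γ` on `[a, b]` matter). -/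
noncomputable def curveLength {X : Type*} [MetricSpace X] (γ : ℝ → X) (a b : ℝ) : ℝ≥0∞ :=
  eVariationOn γ (Icc a b)

/-- `γ` restricted to `[a, b]` is a rectifiable curve: continuous and of finite length. -/
def IsRectifiableCurve {X : Type*} [MetricSpace X] (γ : ℝ → X) (a b : ℝ) : Prop :=
  ContinuousOn γ (Icc a b) ∧ curveLength γ a b < ∞

/-- Quasiconvex metric spaces: any two points `x`, `y` are joined by a rectifiable curve of length
at most `C * d(x, y)`, with `C ≥ 1` independent of the points. -/
def IsQuasiconvexSpace (X : Type*) [MetricSpace X] : Prop :=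
  ∃ C : ℝ≥0, 1 ≤ C ∧ ∀ x y : X, ∃ γ : ℝ → X,
    IsRectifiableCurve γ 0 1 ∧ γ 0 = x ∧ γ 1 = y ∧ curveLength γ 0 1 ≤ C * edist x y

/-- Mappings of weak bounded length distortion (weak BLD). -/
def IsWeakBLD {X Y : Type*} [MetricSpace X] [MetricSpace Y] (Φ : X → Y) : Prop :=
  ∃ M : ℝ≥0, 1 ≤ M ∧ ∀ (a b : ℝ) (γ : ℝ → X), a ≤ b → IsRectifiableCurve γ a b →
    (M : ℝ≥0∞)⁻¹ * curveLength γ a b ≤ curveLength (Φ ∘ γ) a b ∧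
      curveLength (Φ ∘ γ) a b ≤ M * curveLength γ a b

/-- `x` is a (Lebesgue) density point of `S ⊆ ℝ^k`. -/
def IsDensityPoint {k : ℕ} (S : Set (EuclideanSpace ℝ (Fin k)))
    (x : EuclideanSpace ℝ (Fin k)) : Prop :=
  Tendsto (fun r : ℝ => volume (S ∩ Metric.closedBall x r) / volume (Metric.closedBall x r))
    (𝓝[>] 0) (𝓝 1)

/-- The real function `u` on `E ⊆ ℝ^k` is approximately differentiable at `x ∈ E` with approximate
derivative (written as a vector) `v`: there is a measurable `S ⊆ E` with density point `x` such that
`(u y - u x - ⟪v, y - x⟫) / ‖y - x‖ → 0` as `y → x` within `S`. -/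
def HasApproxGradientAt {k : ℕ} (u : EuclideanSpace ℝ (Fin k) → ℝ)
    (v : EuclideanSpace ℝ (Fin k)) (E : Set (EuclideanSpace ℝ (Fin k)))
    (x : EuclideanSpace ℝ (Fin k)) : Prop :=
  ∃ S : Set (EuclideanSpace ℝ (Fin k)), S ⊆ E ∧ NullMeasurableSet S volume ∧
    IsDensityPoint S x ∧ HasGradientWithinAt u v S x

/-- The `∞ × k` matrix `A` is the approximate derivative at `x ∈ E` of the map
`g = (g₀, g₁, …) : E → ℓ^∞`: row `i` of `A` is the approximate derivative of `gᵢ` at `x`. -/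
def HasApproxDerivAt {k : ℕ} (g : EuclideanSpace ℝ (Fin k) → EllInfty)
    (A : Matrix ℕ (Fin k) ℝ) (E : Set (EuclideanSpace ℝ (Fin k)))
    (x : EuclideanSpace ℝ (Fin k)) : Prop :=
  ∀ i : ℕ, HasApproxGradientAt (fun y => g y i) (WithLp.toLp 2 (A i)) E x

/-! Extend each coordinate of `Φ ∘ f` from `E` to a Lipschitz function `G i` on all of ℝ^k. At
almost every point of `E` the approximate derivatives are the ordinary derivatives of the `G i`,
because derivatives within a set are unique at its density points. So condition 3 says that for
almost every point of `E` the derivatives of all the `G i` share a nonzero kernel vector.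

1 → 2 holds because Φ is Lipschitz. For 2 → 3, where there is no common kernel, finitely many
coordinates already have an injective joint derivative. A map into ℝ^n with injective derivative is
bounded below on countably many pieces, so only a null set can have a null image
(`hausdorffMeasure_eq_zero_of_injective_fderiv`).

3 → 1 is the heart: `f` itself has no derivative, and only lengths of curves can be compared.
Suppose that on a compact `K` every `G i` has slope at most ε in a unit direction `v`. Near a
density point of `K`, a displacement along `v` of size at most r is realised, after a translation of
size at most εr, by a segment with endpoints in `K` and all but a fraction ε of it in `K`
(`IsDensityPoint.exists_segment`). Quasiconvexity extends `f` from the part in `K` to a curve along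
the whole segment. Its image under Φ has length O(εr), hence by weak BLD so does the curve
(`edist_le_of_weakBLD`). Thus `f` is locally dominated by the linear map contracting `v` by ε, of
determinant ε, and the measure of `f '' K` is at most c·ε times that of `K`, with c independent of
ε. Sorting the points of `E` by a dense sequence of directions and letting ε → 0 gives the claim. -/

/-! ### Arc length, Lipschitz joining curves, and Lipschitz continuity of Φ -/

/-- The length function of a continuous curve of bounded variation is continuous. -/
theorem BoundedVariationOn.continuousOn_variationOnFromTo {X : Type*} [PseudoMetricSpace X]
    {γ : ℝ → X} {a b : ℝ} (hab : a ≤ b) (hγ : BoundedVariationOn γ (Icc a b))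
    (hc : ContinuousOn γ (Icc a b)) :
    ContinuousOn (variationOnFromTo γ (Icc a b) a) (Icc a b) := by
  intro x hx
  have hloc := hγ.locallyBoundedVariationOn
  have ha : a ∈ Icc a b := left_mem_Icc.2 hab
  have hl := hγ.tendsto_eVariationOn_Icc_zero_left (x := x) ((hc x hx).mono inter_subset_left)
  have hr := hγ.tendsto_eVariationOn_Icc_zero_right x ((hc x hx).mono inter_subset_left)
  have hl' := (ENNReal.tendsto_toReal (by simp)).comp hl
  have hr' := (ENNReal.tendsto_toReal (by simp)).comp hr
  have hs := hl'.add hr'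
  simp only [ENNReal.toReal_zero, add_zero] at hs
  rw [ContinuousWithinAt, tendsto_iff_dist_tendsto_zero]
  refine squeeze_zero' (Eventually.of_forall fun _ => dist_nonneg) ?_ hs
  filter_upwards [self_mem_nhdsWithin] with y hy
  rw [Real.dist_eq, variationOnFromTo.sub_right hloc ha hy hx]
  simp only [Function.comp_apply]
  rcases le_total x y with h | h
  · rw [variationOnFromTo.eq_of_le _ _ h, abs_of_nonneg ENNReal.toReal_nonneg]
    exact le_add_of_nonneg_left ENNReal.toReal_nonneg
  · rw [variationOnFromTo.eq_of_ge _ _ h, abs_neg, abs_of_nonneg ENNReal.toReal_nonneg]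
    exact le_add_of_nonneg_right ENNReal.toReal_nonneg

/-- A rectifiable curve on `[0, 1]` can be reparametrized proportionally to arc length. -/
theorem exists_lipschitzOnWith_reparametrization {X : Type*} [MetricSpace X] {γ : ℝ → X}
    (hγ : IsRectifiableCurve γ 0 1) :
    ∃ p : ℝ → X, LipschitzOnWith (curveLength γ 0 1).toNNReal p (Icc 0 1) ∧
      p 0 = γ 0 ∧ p 1 = γ 1 := by
  obtain ⟨hc, hlen⟩ := hγ
  have hbv : BoundedVariationOn γ (Icc 0 1) := hlen.ne
  have hloc := hbv.locallyBoundedVariationOn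
  have h0 : (0 : ℝ) ∈ Icc (0 : ℝ) 1 := by simp
  have h1 : (1 : ℝ) ∈ Icc (0 : ℝ) 1 := by simp
  set V := variationOnFromTo γ (Icc (0 : ℝ) 1) 0 with hV
  have hV0 : V 0 = 0 := variationOnFromTo.self _ _ _
  have hV1 : V 1 = (curveLength γ 0 1).toReal := by
    rw [hV, variationOnFromTo.eq_of_le _ _ zero_le_one, inter_self, curveLength]
  -- The unit speed property is only available on the range of `V`. Continuity of arc length makes
  -- that range all of `[0, V 1]`.
  have himg : Icc 0 (V 1) ⊆ V '' Icc 0 1 := by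
    have := intermediate_value_Icc zero_le_one (hbv.continuousOn_variationOnFromTo zero_le_one hc)
    rwa [← hV, hV0] at this
  have hunit := has_unit_speed_naturalParameterization γ hloc h0
  rw [← hV] at hunit
  have hp : ∀ t ∈ Icc (0 : ℝ) 1,
      naturalParameterization γ (Icc 0 1) 0 (V t) = γ t := fun t ht =>
    edist_eq_zero.1 (edist_naturalParameterization_eq_zero hloc h0 ht)
  refine ⟨fun t => naturalParameterization γ (Icc 0 1) 0 (V 1 * t), ?_, ?_, ?_⟩
  · have hV1n : 0 ≤ V 1 := hV1 ▸ ENNReal.toReal_nonneg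
    have hmem : ∀ t ∈ Icc (0 : ℝ) 1, V 1 * t ∈ V '' Icc 0 1 := fun t ht =>
      himg ⟨mul_nonneg hV1n ht.1, mul_le_of_le_one_right hV1n ht.2⟩
    have key : ∀ s ∈ Icc (0 : ℝ) 1, ∀ t ∈ Icc (0 : ℝ) 1, s ≤ t →
        edist (naturalParameterization γ (Icc 0 1) 0 (V 1 * s))
          (naturalParameterization γ (Icc 0 1) 0 (V 1 * t)) ≤
          (curveLength γ 0 1).toNNReal * edist s t := by
      intro s hs t ht hst
      have hle : V 1 * s ≤ V 1 * t := mul_le_mul_of_nonneg_left hst hV1n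
      refine (eVariationOn.edist_le _ (s := V '' Icc 0 1 ∩ Icc (V 1 * s) (V 1 * t))
        ⟨hmem s hs, le_rfl, hle⟩ ⟨hmem t ht, hle, le_rfl⟩).trans ?_
      rw [hunit (hmem s hs) (hmem t ht), edist_comm s t, edist_dist, Real.dist_eq,
        abs_of_nonneg (sub_nonneg.2 hst), NNReal.coe_one, one_mul, ← mul_sub,
        ENNReal.ofReal_mul hV1n, hV1, ENNReal.ofReal_toReal hlen.ne, ENNReal.coe_toNNReal hlen.ne]
    intro s hs t ht
    rcases le_total s t with h | h
    · exact key s hs t ht h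
    · rw [edist_comm, edist_comm s t]; exact key t ht s hs h
  · simpa [hV0] using hp 0 h0
  · simpa using hp 1 h1

/-- In a quasiconvex space, points are joined by Lipschitz curves with controlled constant. -/
theorem IsQuasiconvexSpace.exists_lipschitz_curves {X : Type*} [MetricSpace X]
    (hX : IsQuasiconvexSpace X) :
    ∃ C : ℝ≥0, 1 ≤ C ∧ ∀ x y : X, ∃ γ : ℝ → X,
      LipschitzOnWith (C * nndist x y) γ (Icc 0 1) ∧ γ 0 = x ∧ γ 1 = y := by
  obtain ⟨C, hC, h⟩ := hX
  refine ⟨C, hC, fun x y => ?_⟩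
  obtain ⟨γ, hγ, h0, h1, hlen⟩ := h x y
  obtain ⟨p, hp, hp0, hp1⟩ := exists_lipschitzOnWith_reparametrization hγ
  refine ⟨p, hp.weaken ?_, hp0.trans h0, hp1.trans h1⟩
  rw [← ENNReal.coe_le_coe, ENNReal.coe_toNNReal hγ.2.ne]
  rwa [ENNReal.coe_mul, ← edist_nndist]

/-- A weak BLD mapping on a quasiconvex space is Lipschitz. -/
theorem IsWeakBLD.exists_lipschitzWith {X Y : Type*} [MetricSpace X] [MetricSpace Y] {Φ : X → Y}
    (hΦ : IsWeakBLD Φ) (hX : IsQuasiconvexSpace X) : ∃ Q : ℝ≥0, LipschitzWith Q Φ := by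
  obtain ⟨M, -, hM⟩ := hΦ
  obtain ⟨C, -, h⟩ := hX
  refine ⟨M * C, fun x y => ?_⟩
  obtain ⟨γ, hγ, h0, h1, hlen⟩ := h x y
  calc edist (Φ x) (Φ y) = edist ((Φ ∘ γ) 0) ((Φ ∘ γ) 1) := by simp [h0, h1]
    _ ≤ curveLength (Φ ∘ γ) 0 1 := eVariationOn.edist_le _ (by simp) (by simp)
    _ ≤ M * curveLength γ 0 1 := (hM 0 1 γ zero_le_one hγ).2
    _ ≤ M * (C * edist x y) := by gcongr
    _ = _ := by rw [ENNReal.coe_mul, mul_assoc]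

/-! ### Increments controlled by measures, and curves extended across gaps -/

theorem measure_Ioc_add_Ioc (ρ : Measure ℝ) {a b c : ℝ} (hab : a ≤ b) (hbc : b ≤ c) :
    ρ (Ioc a b) + ρ (Ioc b c) = ρ (Ioc a c) := by
  rw [← Ioc_union_Ioc_eq_Ioc hab hbc, measure_union (by simp) measurableSet_Ioc]

/-- If increments of `h` are controlled by a measure between points of a closed set `K` and across
the gaps of `K`, then they are controlled everywhere. -/
theorem edist_le_measure_of_gaps {Y : Type*} [PseudoEMetricSpace Y] {h : ℝ → Y} {K : Set ℝ}
    (hK : IsClosed K) (ρ : Measure ℝ) {a b : ℝ}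
    (hmem : ∀ s ∈ K, ∀ t ∈ K, s ≤ t → s ∈ Icc a b → t ∈ Icc a b → edist (h s) (h t) ≤ ρ (Ioc s t))
    (hgap : ∀ s ∈ Icc a b, ∀ t ∈ Icc a b, s < t → Disjoint (Ioo s t) K →
      edist (h s) (h t) ≤ ρ (Ioc s t)) {s t : ℝ} (hs : s ∈ Icc a b) (ht : t ∈ Icc a b)
    (hst : s ≤ t) : edist (h s) (h t) ≤ ρ (Ioc s t) := by
  have hgap' : ∀ s ∈ Icc a b, ∀ t ∈ Icc a b, s ≤ t → Disjoint (Ioo s t) K →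
      edist (h s) (h t) ≤ ρ (Ioc s t) := by
    intro s hs t ht hst hd
    rcases hst.eq_or_lt with rfl | hlt
    · simp
    · exact hgap s hs t ht hlt hd
  rcases (K ∩ Icc s t).eq_empty_or_nonempty with he | hne
  · refine hgap' s hs t ht hst ?_
    rw [Set.disjoint_left]
    intro u hu huK
    exact notMem_empty u (he ▸ ⟨huK, hu.1.le, hu.2.le⟩)
  · have hcomp : IsCompact (K ∩ Icc s t) := isCompact_Icc.inter_left hK
    -- Cut `[s, t]` at the first and last points of `K`: the two outer pieces are gaps, the middle
    -- one has endpoints in `K`.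
    obtain ⟨p, ⟨hpK, hsp, hpt⟩, hpmin⟩ := hcomp.exists_isLeast hne
    obtain ⟨q, ⟨hqK, hsq, hqt⟩, hqmax⟩ := hcomp.exists_isGreatest hne
    have hpq : p ≤ q := hqmax ⟨hpK, hsp, hpt⟩
    have hp : p ∈ Icc a b := ⟨hs.1.trans hsp, hpt.trans ht.2⟩
    have hq : q ∈ Icc a b := ⟨hs.1.trans hsq, hqt.trans ht.2⟩
    have h1 : edist (h s) (h p) ≤ ρ (Ioc s p) := hgap' s hs p hp hsp <| by
      rw [Set.disjoint_left]
      exact fun u hu huK => (hpmin ⟨huK, hu.1.le, hu.2.le.trans hpt⟩).not_gt hu.2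
    have h2 : edist (h q) (h t) ≤ ρ (Ioc q t) := hgap' q hq t ht hqt <| by
      rw [Set.disjoint_left]
      exact fun u hu huK => (hqmax ⟨huK, hsq.trans hu.1.le, hu.2.le⟩).not_gt hu.1
    calc edist (h s) (h t) ≤ edist (h s) (h p) + edist (h p) (h q) + edist (h q) (h t) :=
          edist_triangle4 _ _ _ _
      _ ≤ ρ (Ioc s p) + ρ (Ioc p q) + ρ (Ioc q t) := by
          gcongr
          exact hmem p hpK q hqK hpq hp hq
      _ = ρ (Ioc s t) := by
          rw [measure_Ioc_add_Ioc ρ hsp hpq, measure_Ioc_add_Ioc ρ (hsp.trans hpq) hqt]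

/-- Additivity of ρ on consecutive half-open intervals makes the sum over a partition telescope.
Controlling increments by a measure rather than a single constant lets the speed bound differ on a
set and its complement. -/
theorem eVariationOn_Icc_le_measure {Y : Type*} [PseudoEMetricSpace Y] {h : ℝ → Y} (ρ : Measure ℝ)
    {a b : ℝ} (H : ∀ s ∈ Icc a b, ∀ t ∈ Icc a b, s ≤ t → edist (h s) (h t) ≤ ρ (Ioc s t)) :
    eVariationOn h (Icc a b) ≤ ρ (Ioc a b) := by
  refine iSup_le ?_
  rintro ⟨n, u, hu, hus⟩
  have : ∀ n, ∑ i ∈ Finset.range n, edist (h (u (i + 1))) (h (u i)) ≤ ρ (Ioc (u 0) (u n)) := by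
    intro n
    induction n with
    | zero => simp
    | succ n ih =>
      rw [Finset.sum_range_succ, ← measure_Ioc_add_Ioc ρ (hu (Nat.zero_le n)) (hu n.le_succ)]
      refine add_le_add ih ?_
      rw [edist_comm]
      exact H _ (hus _) _ (hus _) (hu n.le_succ)
  exact (this n).trans (measure_mono (Ioc_subset_Ioc (hus 0).1 (hus n).2))

/-- In a space whose points are joined by Lipschitz curves, a Lipschitz map on a compact subset of
`[0, 1]` containing the endpoints extends to a Lipschitz curve. -/
theorem exists_lipschitzOnWith_extension_Icc {X : Type*} [MetricSpace X] {C : ℝ≥0} (hC : 1 ≤ C)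
    (hX : ∀ x y : X, ∃ γ : ℝ → X,
      LipschitzOnWith (C * nndist x y) γ (Icc 0 1) ∧ γ 0 = x ∧ γ 1 = y)
    {K : Set ℝ} (hK : IsClosed K) (h0 : (0 : ℝ) ∈ K) (h1 : (1 : ℝ) ∈ K)
    {c : ℝ → X} {Λ : ℝ≥0} (hc : LipschitzOnWith Λ c K) :
    ∃ c' : ℝ → X, LipschitzOnWith (C * Λ) c' (Icc 0 1) ∧ ∀ s ∈ K, c' s = c s := by
  choose γ hγ hγ0 hγ1 using hX
  set A : ℝ → ℝ := fun s => sSup (K ∩ Iic s) with hA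
  set B : ℝ → ℝ := fun s => sInf (K ∩ Ici s) with hB
  -- `A s` and `B s` are the nearest points of `K` on either side of `s`. On `K` they coincide, and
  -- the convention 0/0 = 0 picks the starting point `c s`.
  set c' : ℝ → X := fun s => γ (c (A s)) (c (B s)) ((s - A s) / (B s - A s)) with hc'
  have hAmem : ∀ s, 0 ≤ s → IsGreatest (K ∩ Iic s) (A s) := fun s hs =>
    ⟨(hK.inter isClosed_Iic).csSup_mem ⟨0, h0, hs⟩ ⟨s, fun u hu => hu.2⟩,
      fun u hu => le_csSup ⟨s, fun u hu => hu.2⟩ hu⟩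
  have hBmem : ∀ s, s ≤ 1 → IsLeast (K ∩ Ici s) (B s) := fun s hs =>
    ⟨(hK.inter isClosed_Ici).csInf_mem ⟨1, h1, hs⟩ ⟨s, fun u hu => hu.2⟩,
      fun u hu => csInf_le ⟨s, fun u hu => hu.2⟩ hu⟩
  have hself : ∀ s ∈ K, c' s = c s := by
    intro s hs
    have e1 : A s = s := by
      have : IsGreatest (K ∩ Iic s) s := ⟨⟨hs, self_mem_Iic⟩, fun u hu => hu.2⟩
      exact this.csSup_eq
    have e2 : B s = s := by
      have : IsLeast (K ∩ Ici s) s := ⟨⟨hs, self_mem_Ici⟩, fun u hu => hu.2⟩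
      exact this.csInf_eq
    simp [hc', e1, e2, hγ0]
  have hformula : ∀ a ∈ K, ∀ b ∈ K, a < b → Disjoint (Ioo a b) K → ∀ s ∈ Icc a b,
      c' s = γ (c a) (c b) ((s - a) / (b - a)) := by
    intro a ha b hb hab hd s hs
    rcases hs.1.eq_or_lt with rfl | hlt
    · rw [hself _ ha]; simp [hγ0]
    rcases hs.2.eq_or_lt with rfl | hlt'
    · rw [hself _ hb, div_self (sub_pos.2 hab).ne', hγ1]
    have hd' := Set.disjoint_left.1 hd
    have e1 : A s = a := by
      have : IsGreatest (K ∩ Iic s) a := ⟨⟨ha, hs.1⟩, fun u hu => by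
        by_contra! hu'
        exact hd' ⟨hu', lt_of_le_of_lt hu.2 hlt'⟩ hu.1⟩
      exact this.csSup_eq
    have e2 : B s = b := by
      have : IsLeast (K ∩ Ici s) b := ⟨⟨hb, hs.2⟩, fun u hu => by
        by_contra! hu'
        exact hd' ⟨lt_of_lt_of_le hlt hu.2, hu'⟩ hu.1⟩
      exact this.csInf_eq
    simp only [hc', e1, e2]
  refine ⟨c', ?_, hself⟩
  have key : ∀ s ∈ Icc (0 : ℝ) 1, ∀ t ∈ Icc (0 : ℝ) 1, s ≤ t →
      edist (c' s) (c' t) ≤ (((C * Λ : ℝ≥0) : ℝ≥0∞) • (volume : Measure ℝ)) (Ioc s t) := by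
    intro s hs t ht hst
    refine edist_le_measure_of_gaps hK _ ?_ ?_ hs ht hst
    · intro s hs t ht hst _ _
      rw [hself s hs, hself t ht]
      refine (hc hs ht).trans ?_
      rw [Measure.smul_apply, Real.volume_Ioc, smul_eq_mul, edist_comm, edist_dist, Real.dist_eq,
        abs_of_nonneg (sub_nonneg.2 hst)]
      gcongr
      exact le_mul_of_one_le_left zero_le hC
    · intro s hs t ht hst hd
      have ha := hAmem s hs.1
      have hb := hBmem t ht.2
      have has : A s ≤ s := ha.1.2
      have htb : t ≤ B t := hb.1.2
      have hab : A s < B t := by linarith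
      -- Enlarging `(s, t)` to the gap bounded by points of `K` puts both `s` and `t` on one joining
      -- curve.
      have hd2 : Disjoint (Ioo (A s) (B t)) K := by
        rw [Set.disjoint_left] at hd ⊢
        intro u hu huK
        rcases le_or_gt u s with h | h
        · exact (ha.2 ⟨huK, h⟩).not_gt hu.1
        rcases le_or_gt t u with h' | h'
        · exact (hb.2 ⟨huK, h'⟩).not_gt hu.2
        exact hd ⟨h, h'⟩ huK
      have hba : 0 < B t - A s := sub_pos.2 hab
      have hfrac : ∀ u ∈ Icc (A s) (B t), (u - A s) / (B t - A s) ∈ Icc (0 : ℝ) 1 := fun u hu =>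
        ⟨div_nonneg (sub_nonneg.2 hu.1) hba.le,
          (div_le_one hba).2 (sub_le_sub_right hu.2 _)⟩
      have hsI : s ∈ Icc (A s) (B t) := ⟨has, by linarith⟩
      have htI : t ∈ Icc (A s) (B t) := ⟨by linarith, htb⟩
      rw [hformula _ ha.1.1 _ hb.1.1 hab hd2 s hsI, hformula _ ha.1.1 _ hb.1.1 hab hd2 t htI]
      have hdist := (hγ (c (A s)) (c (B t))).dist_le_mul _ (hfrac s hsI) _ (hfrac t htI)
      have hcd := hc.dist_le_mul _ ha.1.1 _ hb.1.1
      rw [Measure.smul_apply, Real.volume_Ioc, smul_eq_mul, edist_dist,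
        ← ENNReal.ofReal_coe_nnreal, ← ENNReal.ofReal_mul (by positivity)]
      refine ENNReal.ofReal_le_ofReal (hdist.trans ?_)
      rw [Real.dist_eq, ← sub_div, abs_div, abs_of_pos hba, abs_sub_comm,
        abs_of_nonneg (by linarith : 0 ≤ t - A s - (s - A s))]
      rw [dist_comm (A s), Real.dist_eq, abs_of_pos hba] at hcd
      push_cast
      calc (C : ℝ) * dist (c (A s)) (c (B t)) * ((t - A s - (s - A s)) / (B t - A s))
          ≤ C * (Λ * (B t - A s)) * ((t - A s - (s - A s)) / (B t - A s)) := by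
            gcongr
            exact div_nonneg (by linarith) hba.le
        _ = C * Λ * (t - s) := by field_simp; ring
  have key' : ∀ s ∈ Icc (0 : ℝ) 1, ∀ t ∈ Icc (0 : ℝ) 1, s ≤ t →
      edist (c' s) (c' t) ≤ (C * Λ : ℝ≥0) * edist s t := by
    intro s hs t ht hst
    refine (key s hs t ht hst).trans_eq ?_
    rw [Measure.smul_apply, Real.volume_Ioc, smul_eq_mul, edist_comm, edist_dist, Real.dist_eq,
        abs_of_nonneg (sub_nonneg.2 hst)]
  intro s hs t ht
  rcases le_total s t with h | h
  · exact key' s hs t ht h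
  · rw [edist_comm, edist_comm s t]; exact key' t ht s hs h

/-- Increment bound for a Lipschitz function whose derivative is small on a closed set `K`. -/
theorem LipschitzWith.edist_le_of_norm_deriv_le {φ : ℝ → ℝ} {Λ δ : ℝ≥0} (hφ : LipschitzWith Λ φ)
    {K : Set ℝ} (hK : IsClosed K) (hd : ∀ s ∈ K, |deriv φ s| ≤ δ) {s t : ℝ} (hst : s ≤ t) :
    edist (φ s) (φ t) ≤
      ((δ : ℝ≥0∞) • volume + (Λ : ℝ≥0∞) • volume.restrict Kᶜ : Measure ℝ) (Ioc s t) := by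
  have h_integral :=
    (hφ.lipschitzOnWith (s := uIcc s t)).absolutelyContinuousOnInterval.integral_deriv_eq_sub
  rw [edist_comm, edist_dist, Real.dist_eq, ← h_integral, intervalIntegral.integral_of_le hst,
    ← Real.norm_eq_abs, ofReal_norm]
  refine (enorm_integral_le_lintegral_enorm _).trans ?_
  calc ∫⁻ x in Ioc s t, ‖deriv φ x‖ₑ
      ≤ ∫⁻ x in Ioc s t, ((δ : ℝ≥0∞) + Kᶜ.indicator (fun _ => (Λ : ℝ≥0∞)) x) := by
        refine lintegral_mono fun x => ?_
        by_cases hx : x ∈ K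
        · refine le_add_right ?_
          have := hd x hx
          rw [← ofReal_norm, Real.norm_eq_abs]
          exact ENNReal.ofReal_le_of_le_toReal (by simpa using this)
        · rw [indicator_of_mem (by exact hx)]
          refine le_add_left ?_
          have := norm_deriv_le_of_lipschitz (x₀ := x) hφ
          rw [← ofReal_norm]
          exact ENNReal.ofReal_le_of_le_toReal (by simpa using this)
    _ = _ := by
        rw [lintegral_add_left measurable_const, lintegral_indicator hK.isOpen_compl.measurableSet,
          Measure.restrict_restrict hK.isOpen_compl.measurableSet, Measure.add_apply,
          Measure.smul_apply, Measure.smul_apply, Measure.restrict_apply measurableSet_Ioc,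
          inter_comm, lintegral_const, lintegral_const, Measure.restrict_apply_univ,
          Measure.restrict_apply_univ, smul_eq_mul, smul_eq_mul]

/-- If the coordinates of `Φ ∘ c` have derivative at most `δ` on `K ⊆ [0, 1]`, then the weak BLD
condition bounds the displacement of `c`. -/
theorem edist_le_of_weakBLD {X : Type*} [MetricSpace X] {C : ℝ≥0} (hC : 1 ≤ C)
    (hX : ∀ x y : X, ∃ γ : ℝ → X,
      LipschitzOnWith (C * nndist x y) γ (Icc 0 1) ∧ γ 0 = x ∧ γ 1 = y)
    {Φ : X → EllInfty} {M Q : ℝ≥0} (hM : 1 ≤ M)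
    (hΦ : ∀ γ : ℝ → X, IsRectifiableCurve γ 0 1 →
      (M : ℝ≥0∞)⁻¹ * curveLength γ 0 1 ≤ curveLength (Φ ∘ γ) 0 1)
    (hQ : LipschitzWith Q Φ) {K : Set ℝ} (hK : IsClosed K) (h0 : (0 : ℝ) ∈ K) (h1 : (1 : ℝ) ∈ K)
    {c : ℝ → X} {Λ δ : ℝ≥0} (hc : LipschitzOnWith Λ c K) {φ : ℕ → ℝ → ℝ}
    (hφ : ∀ i, LipschitzWith (Q * (C * Λ)) (φ i)) (hφc : ∀ i, ∀ s ∈ K, φ i s = Φ (c s) i)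
    (hd : ∀ i, ∀ s ∈ K, |deriv (φ i) s| ≤ δ) :
    edist (c 0) (c 1) ≤ M * (δ + Q * (C * Λ) * volume (Ioc 0 1 \ K)) := by
  obtain ⟨c', hc', heq⟩ := exists_lipschitzOnWith_extension_Icc hC hX hK h0 h1 hc
  -- Speed at most δ everywhere, plus the crude Lipschitz speed off `K`. One measure serves all
  -- coordinates, so the supremum norm obeys the same bound.
  set ρ : Measure ℝ :=
    (δ : ℝ≥0∞) • volume + ((Q * (C * Λ) : ℝ≥0) : ℝ≥0∞) • volume.restrict Kᶜ with hρ
  have hcQ : LipschitzOnWith (Q * (C * Λ)) (Φ ∘ c') (Icc 0 1) :=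
    hQ.lipschitzOnWith.comp hc' (mapsTo_univ _ _)
  have hinc : ∀ s ∈ Icc (0 : ℝ) 1, ∀ t ∈ Icc (0 : ℝ) 1, s ≤ t →
      edist ((Φ ∘ c') s) ((Φ ∘ c') t) ≤ ρ (Ioc s t) := by
    intro s hs t ht hst
    refine edist_le_measure_of_gaps hK ρ ?_ ?_ hs ht hst
    · intro s hs t ht hst _ _
      simp only [Function.comp_apply, heq s hs, heq t ht]
      have hfin : ρ (Ioc s t) ≠ ∞ := by
        simp only [hρ, Measure.add_apply, Measure.smul_apply, smul_eq_mul]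
        exact ENNReal.add_ne_top.2 ⟨ENNReal.mul_ne_top (by simp) (by simp),
          ENNReal.mul_ne_top ENNReal.coe_ne_top
            ((Measure.restrict_apply_le _ _).trans_lt (by simp)).ne⟩
      rw [edist_dist]
      refine ENNReal.ofReal_le_of_le_toReal ?_
      rw [dist_eq_norm]
      refine lp.norm_le_of_forall_le ENNReal.toReal_nonneg fun i => ?_
      have := (hφ i).edist_le_of_norm_deriv_le hK (hd i) hst
      rw [edist_dist, hφc i s hs, hφc i t ht] at this
      have h2 := (ENNReal.ofReal_le_iff_le_toReal hfin).1 this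
      rwa [dist_eq_norm] at h2
    · intro s hs t ht hst hd
      refine (hcQ hs ht).trans ?_
      have hr : ENNReal.ofReal (t - s) ≤ (volume.restrict Kᶜ) (Ioc s t) := by
        rw [← Real.volume_Ioo, Measure.restrict_apply measurableSet_Ioc]
        exact measure_mono fun u hu => ⟨Ioo_subset_Ioc_self hu, Set.disjoint_left.1 hd hu⟩
      simp only [hρ, Measure.add_apply, Measure.smul_apply, smul_eq_mul]
      refine le_add_left ?_
      rw [edist_comm, edist_dist, Real.dist_eq, abs_of_pos (sub_pos.2 hst)]
      gcongr
  have hrect : IsRectifiableCurve c' 0 1 := by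
    refine ⟨hc'.continuousOn, ?_⟩
    refine (eVariationOn_Icc_le_measure (((C * Λ : ℝ≥0) : ℝ≥0∞) • volume)
      fun s hs t ht hst => ?_).trans_lt (by simp [ENNReal.mul_lt_top])
    refine (hc' hs ht).trans_eq ?_
    rw [Measure.smul_apply, Real.volume_Ioc, smul_eq_mul, edist_comm, edist_dist, Real.dist_eq,
        abs_of_nonneg (sub_nonneg.2 hst)]
  have hM0 : (M : ℝ≥0∞) ≠ 0 := by
    simpa using (zero_lt_one.trans_le hM).ne'
  have hlen := (hΦ c' hrect).trans (eVariationOn_Icc_le_measure ρ hinc)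
  rw [ENNReal.inv_mul_le_iff hM0 (by simp)] at hlen
  calc edist (c 0) (c 1) = edist (c' 0) (c' 1) := by rw [heq 0 h0, heq 1 h1]
    _ ≤ curveLength c' 0 1 := eVariationOn.edist_le _ (by simp) (by simp)
    _ ≤ M * ρ (Ioc 0 1) := hlen
    _ = _ := by
      simp [hρ, Measure.restrict_apply measurableSet_Ioc, sdiff_eq]

/-! ### Density points: nearby segments and uniqueness of derivatives -/

theorem ae_isDensityPoint {k : ℕ} (S : Set (EuclideanSpace ℝ (Fin k))) :
    ∀ᵐ x ∂volume.restrict S, IsDensityPoint S x :=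
  Besicovitch.ae_tendsto_measure_inter_div volume S

theorem IsDensityPoint.congr {k : ℕ} {S T : Set (EuclideanSpace ℝ (Fin k))}
    {x : EuclideanSpace ℝ (Fin k)} (hx : IsDensityPoint S x) (hST : T =ᵐ[volume] S) :
    IsDensityPoint T x := by
  refine Tendsto.congr (fun r => ?_) hx
  rw [measure_congr (hST.symm.inter (ae_eq_refl (Metric.closedBall x r)))]

/-- Near a density point of `S`, the complement of `S` has small relative measure in balls. -/
theorem IsDensityPoint.eventually_measure_diff_le {k : ℕ} {S : Set (EuclideanSpace ℝ (Fin k))}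
    {x : EuclideanSpace ℝ (Fin k)} (hx : IsDensityPoint S x) (hS : MeasurableSet S) {δ : ℝ}
    (hδ : 0 < δ) :
    ∀ᶠ r in 𝓝[>] (0 : ℝ), volume (Metric.closedBall x r \ S) ≤
      ENNReal.ofReal δ * volume (Metric.closedBall x r) := by
  have hlt : 1 - ENNReal.ofReal δ < 1 :=
    ENNReal.sub_lt_self (by simp) (by simp) (by simpa using hδ)
  filter_upwards [hx.eventually_const_lt hlt, self_mem_nhdsWithin] with r hr hr0
  have hpos : volume (Metric.closedBall x r) ≠ 0 := (Metric.measure_closedBall_pos _ _ hr0).ne'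
  have hfin : volume (Metric.closedBall x r) ≠ ∞ := measure_closedBall_lt_top.ne
  have h1 := (ENNReal.lt_div_iff_mul_lt (Or.inl hpos) (Or.inl hfin)).1 hr
  have hfin' : volume (S ∩ Metric.closedBall x r) ≠ ∞ :=
    ((measure_mono inter_subset_right).trans_lt measure_closedBall_lt_top).ne
  have h2 : volume (S ∩ Metric.closedBall x r) + volume (Metric.closedBall x r \ S) =
      volume (Metric.closedBall x r) := by
    rw [inter_comm]; exact measure_inter_add_sdiff _ hS
  have h3 : volume (Metric.closedBall x r) ≤
      volume (S ∩ Metric.closedBall x r) + ENNReal.ofReal δ * volume (Metric.closedBall x r) := by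
    calc volume (Metric.closedBall x r)
        ≤ ((1 - ENNReal.ofReal δ) + ENNReal.ofReal δ) * volume (Metric.closedBall x r) :=
          le_mul_of_one_le_left zero_le le_tsub_add
      _ ≤ _ := by rw [add_mul]; gcongr
  exact (ENNReal.add_le_add_iff_left hfin').1 (h2.trans_le h3)

/-- The average over a ball of the part of a translated segment that lies outside of `S`. -/
theorem lintegral_measure_segment_diff_le {F : Type*} [NormedAddCommGroup F] [NormedSpace ℝ F]
    [MeasurableSpace F] [BorelSpace F] [SecondCountableTopology F] (μ : Measure F) [SFinite μ]
    [μ.IsAddRightInvariant] {S R B : Set F} (hS : MeasurableSet S) (w : F) (ν : Measure ℝ)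
    [SFinite ν] (hν : ∀ᵐ s ∂ν, ∀ z ∈ B, z + s • w ∈ R) :
    ∫⁻ z in B, ν {s | z + s • w ∉ S} ∂μ ≤ ν univ * μ (R \ S) := by
  have hmeas : Measurable fun p : F × ℝ => p.1 + p.2 • w := by fun_prop
  have hT : MeasurableSet {p : F × ℝ | p.1 + p.2 • w ∉ S} := hmeas hS.compl
  calc ∫⁻ z in B, ν {s | z + s • w ∉ S} ∂μ
      = ∫⁻ z in B, (∫⁻ s, {p : F × ℝ | p.1 + p.2 • w ∉ S}.indicator 1 (z, s) ∂ν) ∂μ := by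
        refine lintegral_congr fun z => ?_
        have hTz : MeasurableSet {s : ℝ | z + s • w ∉ S} := hT.preimage measurable_prodMk_left
        rw [← lintegral_indicator_one hTz]; rfl
    -- After Tonelli, for fixed `s` the bad `z` are those translated by `s • w` into `R \ S`, and
    -- translation preserves μ.
    _ = ∫⁻ s, (∫⁻ z in B, {p : F × ℝ | p.1 + p.2 • w ∉ S}.indicator 1 (z, s) ∂μ) ∂ν := by
        refine lintegral_lintegral_swap ?_
        exact ((measurable_one.indicator hT).aemeasurable)
    _ ≤ ∫⁻ _, μ (R \ S) ∂ν := by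
        refine lintegral_mono_ae ?_
        filter_upwards [hν] with s hs
        have hTs : MeasurableSet {z : F | z + s • w ∉ S} := hT.preimage measurable_prodMk_right
        calc ∫⁻ z in B, {p : F × ℝ | p.1 + p.2 • w ∉ S}.indicator 1 (z, s) ∂μ
            = (μ.restrict B) {z : F | z + s • w ∉ S} := by
              rw [← lintegral_indicator_one hTs]; rfl
          _ = μ ({z : F | z + s • w ∉ S} ∩ B) := Measure.restrict_apply hTs
          _ ≤ μ ((fun z => z + s • w) ⁻¹' (R \ S)) :=
              measure_mono fun z hz => ⟨hs z hz.2, hz.1⟩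
          _ = μ (R \ S) := measure_preimage_add_right _ _ _
    _ = _ := by rw [lintegral_const, mul_comm]

/-- Near a density point of `S`, every short vector `w` can be realised, up to a small translation,
by a segment with endpoints in `S` most of which lies in `S`. -/
theorem IsDensityPoint.exists_segment {k : ℕ} {S : Set (EuclideanSpace ℝ (Fin k))}
    {x : EuclideanSpace ℝ (Fin k)} (hx : IsDensityPoint S x) (hS : MeasurableSet S) {η : ℝ}
    (hη : 0 < η) (hη1 : η ≤ 1) :
    ∀ᶠ r in 𝓝[>] (0 : ℝ), ∀ w : EuclideanSpace ℝ (Fin k), ‖w‖ ≤ r →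
      ∃ z, ‖z - x‖ ≤ η * r ∧ z ∈ S ∧ z + w ∈ S ∧
        volume (Ioc 0 1 \ {s : ℝ | z + s • w ∈ S}) ≤ ENNReal.ofReal η := by
  -- Chosen so that 3·δ·(2r)^k = (3/4)·η·(ηr)^k. The 3 is the mass of ν below, and 2r is a radius
  -- containing all the segments.
  set δ : ℝ := η * (η / 2) ^ k / 4 with hδ
  have hδ0 : 0 < δ := by positivity
  have htend : Tendsto (fun r : ℝ => 2 * r) (𝓝[>] 0) (𝓝[>] 0) := by
    refine tendsto_nhdsWithin_iff.2 ⟨?_, ?_⟩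
    · exact ((continuous_const.mul continuous_id).tendsto' 0 0 (by simp)).mono_left
        nhdsWithin_le_nhds
    · filter_upwards [self_mem_nhdsWithin] with r hr
      exact mul_pos two_pos (mem_Ioi.1 hr)
  filter_upwards [htend.eventually (hx.eventually_measure_diff_le hS hδ0), self_mem_nhdsWithin]
    with r hr hr0 w hw
  have hr0' : 0 < r := hr0
  -- The unit atoms encode the endpoint conditions: a bad set of ν-mass below η ≤ 1 contains neither
  -- 0 nor 1.
  set ν : Measure ℝ := Measure.dirac 0 + Measure.dirac 1 + volume.restrict (Ioc 0 1) with hνdef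
  have hνuniv : ν univ = 3 := by
    simp [hνdef]; norm_num
  have hν : ∀ᵐ s ∂ν, ∀ z ∈ Metric.closedBall x (η * r), z + s • w ∈ Metric.closedBall x (2 * r) := by
    have main : ∀ s ∈ Icc (0 : ℝ) 1, ∀ z ∈ Metric.closedBall x (η * r),
        z + s • w ∈ Metric.closedBall x (2 * r) := by
      intro s hs z hz
      rw [mem_closedBall_iff_norm] at hz ⊢
      calc ‖z + s • w - x‖ = ‖(z - x) + s • w‖ := by congr 1; abel
        _ ≤ ‖z - x‖ + ‖s • w‖ := norm_add_le _ _
        _ ≤ η * r + 1 * r := by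
          gcongr
          rw [norm_smul, Real.norm_eq_abs, abs_of_nonneg hs.1]
          exact mul_le_mul hs.2 hw (norm_nonneg _) zero_le_one
        _ ≤ 2 * r := by nlinarith
    rw [hνdef, ae_add_measure_iff, ae_add_measure_iff]
    refine ⟨⟨?_, ?_⟩, ?_⟩
    · rw [ae_dirac_eq]; exact main 0 (by simp)
    · rw [ae_dirac_eq]; exact main 1 (by simp)
    · filter_upwards [ae_restrict_mem measurableSet_Ioc] with s hs
      exact main s ⟨hs.1.le, hs.2⟩
  have h_integral := lintegral_measure_segment_diff_le volume hS w ν hν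
  rw [hνuniv] at h_integral
  set b := volume (Metric.closedBall (0 : EuclideanSpace ℝ (Fin k)) 1) with hb
  have hb0 : b ≠ 0 := (Metric.measure_closedBall_pos _ _ one_pos).ne'
  have hbt : b ≠ ∞ := measure_closedBall_lt_top.ne
  have hvol : ∀ ρ : ℝ, 0 ≤ ρ → volume (Metric.closedBall x ρ) = ENNReal.ofReal (ρ ^ k) * b := by
    intro ρ hρ
    rw [Measure.addHaar_closedBall' _ _ hρ, finrank_euclideanSpace_fin]
  obtain ⟨z, hz, hzν⟩ : ∃ z ∈ Metric.closedBall x (η * r),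
      ν {s | z + s • w ∉ S} < ENNReal.ofReal η := by
    by_contra! hcon
    have h1 : ENNReal.ofReal η * volume (Metric.closedBall x (η * r)) ≤
        ∫⁻ z in Metric.closedBall x (η * r), ν {s | z + s • w ∉ S} := by
      rw [← setLIntegral_const]
      exact setLIntegral_mono' measurableSet_closedBall hcon
    have h2 := h1.trans (h_integral.trans (mul_le_mul_right hr 3))
    rw [hvol _ (by positivity), hvol _ (by positivity), ← mul_assoc, ← mul_assoc, ← mul_assoc,
      ← ENNReal.ofReal_mul hη.le, show (3 : ℝ≥0∞) = ENNReal.ofReal 3 by simp,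
      ← ENNReal.ofReal_mul (by norm_num), ← ENNReal.ofReal_mul (by positivity),
      ENNReal.mul_le_mul_iff_left hb0 hbt, ENNReal.ofReal_le_ofReal_iff (by positivity)] at h2
    have : 3 * δ * (2 * r) ^ k = 3 / 4 * (η * (η * r) ^ k) := by
      rw [hδ, div_pow, mul_pow, mul_pow]; field_simp
    have hpos : 0 < η * (η * r) ^ k := by positivity
    linarith
  have hTm : MeasurableSet {s : ℝ | z + s • w ∉ S} := by
    have : Measurable fun s : ℝ => z + s • w := by fun_prop
    exact this hS.compl
  have hexp : ν {s | z + s • w ∉ S} = Measure.dirac 0 {s : ℝ | z + s • w ∉ S} +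
      Measure.dirac 1 {s : ℝ | z + s • w ∉ S} +
        volume.restrict (Ioc 0 1) {s : ℝ | z + s • w ∉ S} := by
    simp only [hνdef, Measure.add_apply]
  have hle1 : ENNReal.ofReal η ≤ 1 := by simpa using hη1
  refine ⟨z, mem_closedBall_iff_norm.1 hz, ?_, ?_, ?_⟩
  · by_contra hcon
    have : Measure.dirac 0 {s : ℝ | z + s • w ∉ S} = 1 := by
      rw [Measure.dirac_apply' _ hTm, indicator_of_mem (by simpa using hcon)]; rfl
    rw [hexp, this, add_assoc] at hzν
    exact (hzν.trans_le hle1).not_ge le_self_add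
  · by_contra hcon
    have : Measure.dirac 1 {s : ℝ | z + s • w ∉ S} = 1 := by
      rw [Measure.dirac_apply' _ hTm, indicator_of_mem (by simpa using hcon)]; rfl
    rw [hexp, this, add_right_comm] at hzν
    exact (hzν.trans_le hle1).not_ge le_add_self
  · rw [hexp, Measure.restrict_apply hTm] at hzν
    refine le_trans ?_ hzν.le
    refine le_trans (measure_mono ?_) le_add_self
    exact fun s hs => ⟨hs.2, hs.1⟩

/-- Derivatives within a set are unique at its density points. -/
theorem IsDensityPoint.hasFDerivWithinAt_unique {k : ℕ} {S : Set (EuclideanSpace ℝ (Fin k))}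
    {x : EuclideanSpace ℝ (Fin k)} (hx : IsDensityPoint S x) (hS : NullMeasurableSet S volume)
    {u : EuclideanSpace ℝ (Fin k) → ℝ} {L₁ L₂ : EuclideanSpace ℝ (Fin k) →L[ℝ] ℝ}
    (h₁ : HasFDerivWithinAt u L₁ S x) (h₂ : HasFDerivWithinAt u L₂ S x) : L₁ = L₂ := by
  obtain ⟨T, hTS, hT, hTae⟩ := hS.exists_measurable_subset_ae_eq
  have hxT := hx.congr hTae
  have hsub := (h₁.mono hTS).sub (h₂.mono hTS)
  set L := L₁ - L₂ with hL
  -- The difference `u - u` vanishes but has derivative `L` within `T`, so `L (y - x)` is o(‖y - x‖)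
  -- along `T`.
  have hlit : ∀ c : ℝ, 0 < c → ∀ᶠ y in 𝓝[T] x, ‖L (y - x)‖ ≤ c * ‖y - x‖ := by
    intro c hc
    have := hsub.isLittleO.bound hc
    filter_upwards [this] with y hy
    simpa [abs_sub_comm] using hy
  rw [← sub_eq_zero, ← hL]
  ext v
  rw [zero_apply]
  by_contra hv
  wlog hv1 : ‖v‖ ≤ 1 generalizing v
  · have hv0 : 0 < ‖v‖ := by linarith
    refine this (‖v‖⁻¹ • v) ?_ ?_
    · rw [map_smul, smul_eq_mul]; exact mul_ne_zero (inv_ne_zero hv0.ne') hv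
    · rw [norm_smul, norm_inv, norm_norm, inv_mul_cancel₀ hv0.ne']
  have hpos : 0 < ‖L v‖ := norm_pos_iff.2 hv
  -- With this η the offset `z - x` contributes at most r‖L v‖/4, and the endpoint in `T` another
  -- r‖L v‖/4. Together they fall short of r‖L v‖.
  set η : ℝ := min 1 (‖L v‖ / (4 * (‖L‖ + 1))) with hη
  have hη0 : 0 < η := by positivity
  have hη1 : η ≤ 1 := min_le_left _ _
  obtain ⟨ε, hε, hball⟩ := Metric.mem_nhdsWithin_iff.1 (hlit (‖L v‖ / 8) (by positivity))
  have hsmall : ∀ᶠ r in 𝓝[>] (0 : ℝ), r < ε / 2 :=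
    mem_nhdsWithin_of_mem_nhds (Iio_mem_nhds (by positivity))
  obtain ⟨r, hr, hrε, hr0⟩ := ((hxT.exists_segment hT hη0 hη1).and
    (hsmall.and self_mem_nhdsWithin)).exists
  have hr0' : 0 < r := hr0
  have hrv : ‖r • v‖ ≤ r := by
    rw [norm_smul, Real.norm_eq_abs, abs_of_pos hr0']; nlinarith
  obtain ⟨z, hzx, -, hzw, -⟩ := hr (r • v) hrv
  have hzx' : ‖z - x‖ ≤ r := hzx.trans (by nlinarith)
  have hdist : ‖z + r • v - x‖ ≤ 2 * r := by
    calc ‖z + r • v - x‖ = ‖(z - x) + r • v‖ := by congr 1; abel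
      _ ≤ 2 * r := (norm_add_le _ _).trans (by linarith)
  have h1 : ‖L (z + r • v - x)‖ ≤ ‖L v‖ / 8 * ‖z + r • v - x‖ :=
    hball ⟨by rw [mem_ball_iff_norm]; linarith, hzw⟩
  have h2 : r * ‖L v‖ ≤ ‖L (z + r • v - x)‖ + ‖L (z - x)‖ := by
    have : r * ‖L v‖ = ‖L (z + r • v - x) - L (z - x)‖ := by
      rw [← map_sub, show z + r • v - x - (z - x) = r • v by abel, map_smul, norm_smul,
        Real.norm_of_nonneg hr0'.le]
    rw [this]; exact norm_sub_le _ _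
  have h3 : ‖L (z - x)‖ ≤ ‖L v‖ / 4 * r := by
    have hη2 : η * (‖L‖ + 1) ≤ ‖L v‖ / 4 := by
      calc η * (‖L‖ + 1) ≤ ‖L v‖ / (4 * (‖L‖ + 1)) * (‖L‖ + 1) := by
            gcongr; exact min_le_right _ _
        _ = ‖L v‖ / 4 := by field_simp
    calc ‖L (z - x)‖ ≤ ‖L‖ * ‖z - x‖ := L.le_opNorm _
      _ ≤ (‖L‖ + 1) * (η * r) := by gcongr; linarith
      _ = η * (‖L‖ + 1) * r := by ring
      _ ≤ _ := by gcongr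
  have h4 : ‖L v‖ / 8 * ‖z + r • v - x‖ ≤ ‖L v‖ / 8 * (2 * r) := by gcongr
  nlinarith [mul_pos hr0' hpos]

/-! ### Comparison of Hausdorff measures of images -/

/-- A map dominated by `S` does not increase Hausdorff measure more than `S` does. -/
theorem hausdorffMeasure_image_le_of_edist_le {α X Y : Type*} [MetricSpace X] [MeasurableSpace X]
    [BorelSpace X] [MetricSpace Y] [MeasurableSpace Y] [BorelSpace Y] {f : α → X} {S : α → Y}
    {A : Set α} {C : ℝ≥0} (h : ∀ x ∈ A, ∀ y ∈ A, edist (f x) (f y) ≤ C * edist (S x) (S y))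
    {d : ℝ} (hd : 0 ≤ d) : μH[d] (f '' A) ≤ (C : ℝ≥0∞) ^ d * μH[d] (S '' A) := by
  rcases isEmpty_or_nonempty α with hα | hα
  · rw [eq_empty_of_isEmpty A]; simp
  set g : Y → α := Function.invFunOn S A with hg
  have hgA : ∀ x ∈ A, g (S x) ∈ A ∧ S (g (S x)) = S x := fun x hx =>
    ⟨Function.invFunOn_mem ⟨x, hx, rfl⟩, Function.invFunOn_eq ⟨x, hx, rfl⟩⟩
  have hlip : LipschitzOnWith C (f ∘ g) (S '' A) := by
    rintro _ ⟨x, hx, rfl⟩ _ ⟨y, hy, rfl⟩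
    have := h _ (hgA x hx).1 _ (hgA y hy).1
    rwa [(hgA x hx).2, (hgA y hy).2] at this
  -- Domination makes `f` constant on the fibres of `S` in `A`, so `f` factors through `S` whichever
  -- preimages `g` selects.
  have himg : f '' A ⊆ (f ∘ g) '' (S '' A) := by
    rintro _ ⟨x, hx, rfl⟩
    refine ⟨S x, ⟨x, hx, rfl⟩, ?_⟩
    have := h _ (hgA x hx).1 _ hx
    rw [(hgA x hx).2, edist_self, mul_zero, nonpos_iff_eq_zero, edist_eq_zero] at this
    exact this
  exact (measure_mono himg).trans (hlip.hausdorffMeasure_image_le hd)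

/-- A countable measurable partition of a separable space into pieces of small diameter. -/
theorem exists_measurable_partition_edist_lt (F : Type*) [PseudoEMetricSpace F]
    [TopologicalSpace.SeparableSpace F] [MeasurableSpace F] [OpensMeasurableSpace F] {r : ℝ≥0∞}
    (hr : 0 < r) : ∃ P : ℕ → Set F, (∀ j, MeasurableSet (P j)) ∧ Pairwise (Function.onFun Disjoint P) ∧
      (⋃ j, P j = univ) ∧ ∀ j, ∀ x ∈ P j, ∀ y ∈ P j, edist x y < r := by
  rcases isEmpty_or_nonempty F with hF | hF
  · exact ⟨fun _ => ∅, by simp, fun i j _ => by simp [Function.onFun], by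
      simp [eq_empty_of_isEmpty], by simp⟩
  set B : ℕ → Set F := fun j => Metric.eball (TopologicalSpace.denseSeq F j) (r / 2) with hB
  refine ⟨disjointed B, MeasurableSet.disjointed fun j => Metric.isOpen_eball.measurableSet,
    disjoint_disjointed _, ?_, ?_⟩
  · rw [iUnion_disjointed, eq_univ_iff_forall]
    intro x
    obtain ⟨_, ⟨j, rfl⟩, hy⟩ := EMetric.mem_closure_iff.1
      ((TopologicalSpace.denseRange_denseSeq F).closure_range ▸ mem_univ x) (r / 2)
      (ENNReal.half_pos hr.ne')
    exact mem_iUnion.2 ⟨j, hy⟩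
  · intro j x hx y hy
    have hx' : edist x _ < r / 2 := disjointed_subset B j hx
    have hy' : edist y _ < r / 2 := disjointed_subset B j hy
    calc edist x y ≤ edist x (TopologicalSpace.denseSeq F j) +
          edist y (TopologicalSpace.denseSeq F j) := edist_triangle_right _ _ _
      _ < r / 2 + r / 2 := ENNReal.add_lt_add hx' hy'
      _ = r := ENNReal.add_halves r

/-- A map which is locally dominated by `S` does not increase Hausdorff measure more than `S`. -/
theorem hausdorffMeasure_image_le_of_eventually_edist_le {F X Y : Type*} [MetricSpace F]
    [MeasurableSpace F] [BorelSpace F] [TopologicalSpace.SeparableSpace F] [MetricSpace X]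
    [MeasurableSpace X] [BorelSpace X] [MetricSpace Y] [MeasurableSpace Y] [BorelSpace Y]
    {f : F → X} {S : F → Y} {D : Set F} {C : ℝ≥0} {d : ℝ} (hd : 0 ≤ d)
    (h : ∀ x ∈ D, ∀ᶠ y in 𝓝[D] x, edist (f x) (f y) ≤ C * edist (S x) (S y)) {c : ℝ≥0∞}
    (hS : ∀ A : Set F, μH[d] (S '' A) ≤ c * μH[d] A) :
    μH[d] (f '' D) ≤ (C : ℝ≥0∞) ^ d * (c * μH[d] D) := by
  -- Points where the domination holds at the uniform scale 1/n. On a piece of `T n` of diameter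
  -- below 1/n it holds for all pairs.
  set T : ℕ → Set F := fun n => {x ∈ D | ∀ y ∈ D, edist x y < (n : ℝ≥0∞)⁻¹ →
    edist (f x) (f y) ≤ C * edist (S x) (S y)} with hT
  have hTmono : Monotone T := by
    intro m n hmn x hx
    refine ⟨hx.1, fun y hy hxy => hx.2 y hy (hxy.trans_le ?_)⟩
    exact ENNReal.inv_le_inv.2 (by exact_mod_cast hmn)
  have hTU : D ⊆ ⋃ n, T n := by
    intro x hx
    obtain ⟨ε, hε, hball⟩ := EMetric.mem_nhdsWithin_iff.1 (h x hx)
    obtain ⟨n, hn⟩ := ENNReal.exists_inv_nat_lt hε.ne'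
    refine mem_iUnion.2 ⟨n, hx, fun y hy hxy => hball ⟨?_, hy⟩⟩
    rw [Metric.mem_eball, edist_comm]
    exact hxy.trans hn
  have himg : f '' D ⊆ ⋃ n, f '' T n := by
    rw [← image_iUnion]; exact image_mono hTU
  refine (measure_mono himg).trans ?_
  rw [Monotone.measure_iUnion (fun m n hmn => image_mono (hTmono hmn))]
  refine iSup_le fun n => ?_
  obtain ⟨P, hPm, hPd, hPU, hPdiam⟩ := exists_measurable_partition_edist_lt F
    (r := (n : ℝ≥0∞)⁻¹) (by simp)
  have hcover : f '' T n ⊆ ⋃ j, f '' (T n ∩ P j) := by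
    rw [← image_iUnion, ← inter_iUnion, hPU, inter_univ]
  calc μH[d] (f '' T n) ≤ ∑' j, μH[d] (f '' (T n ∩ P j)) :=
        (measure_mono hcover).trans (measure_iUnion_le _)
    _ ≤ ∑' j, (C : ℝ≥0∞) ^ d * (c * μH[d] (T n ∩ P j)) := by
        refine ENNReal.tsum_le_tsum fun j => ?_
        refine (hausdorffMeasure_image_le_of_edist_le (S := S) ?_ hd).trans
          (mul_le_mul_right (hS _) _)
        exact fun x hx y hy => hx.1.2 y hy.1.1 (hPdiam j x hx.2 y hy.2)
    -- `T n` need not be measurable. Restricting the measure to it keeps additivity over the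
    -- measurable cells `P j`.
    _ = (C : ℝ≥0∞) ^ d * (c * ∑' j, (μH[d]).restrict (T n) (P j)) := by
        rw [ENNReal.tsum_mul_left, ENNReal.tsum_mul_left]
        simp only [Measure.restrict_apply (hPm _), inter_comm]
    _ = (C : ℝ≥0∞) ^ d * (c * μH[d] (T n)) := by
        rw [← measure_iUnion hPd hPm, hPU, Measure.restrict_apply_univ]
    _ ≤ _ := by
        gcongr
        exact fun x hx => hx.1

theorem isAddHaarMeasure_hausdorffMeasure_euclideanSpace (k : ℕ) :
    (μH[(k : ℝ)] : Measure (EuclideanSpace ℝ (Fin k))).IsAddHaarMeasure := by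
  have := isAddHaarMeasure_hausdorffMeasure (E := EuclideanSpace ℝ (Fin k))
  rwa [finrank_euclideanSpace_fin] at this

/-! ### The model linear map of determinant ε -/

/-- The linear contraction by the factor `ε` in the direction of the unit vector `v`. -/
noncomputable def directionalContraction {F : Type*} [NormedAddCommGroup F]
    [InnerProductSpace ℝ F] (v : F) (ε : ℝ) : F →ₗ[ℝ] F :=
  LinearMap.transvection ((ε - 1) • (innerSL ℝ v).toLinearMap) v

theorem directionalContraction_apply {F : Type*} [NormedAddCommGroup F]
    [InnerProductSpace ℝ F] (v : F) (ε : ℝ) (u : F) :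
    directionalContraction v ε u = (u - inner ℝ v u • v) + (ε * inner ℝ v u) • v := by
  simp only [directionalContraction, LinearMap.transvection.apply, LinearMap.smul_apply,
    ContinuousLinearMap.coe_coe, innerSL_apply_apply, smul_eq_mul]
  module

theorem det_directionalContraction {F : Type*} [NormedAddCommGroup F] [InnerProductSpace ℝ F]
    [FiniteDimensional ℝ F] {v : F} (hv : ‖v‖ = 1) (ε : ℝ) :
    LinearMap.det (directionalContraction v ε) = ε := by
  rw [directionalContraction, LinearMap.transvection.det]
  simp [hv]

theorem norm_sq_directionalContraction {F : Type*} [NormedAddCommGroup F]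
    [InnerProductSpace ℝ F] {v : F} (hv : ‖v‖ = 1) (ε : ℝ) (u : F) :
    ‖directionalContraction v ε u‖ ^ 2 =
      ‖u - inner ℝ v u • v‖ ^ 2 + (ε * inner ℝ v u) ^ 2 := by
  rw [directionalContraction_apply, norm_add_sq_real, inner_smul_right, inner_sub_left,
    real_inner_smul_left, real_inner_self_eq_norm_sq, hv, norm_smul, hv, real_inner_comm,
    mul_one (‖ε * _‖), Real.norm_eq_abs, sq_abs]
  simp

/-- The component orthogonal to `v` is left unchanged, so this part of a displacement is dominated
without losing a factor ε. -/
theorem norm_sub_inner_smul_le_directionalContraction {F : Type*} [NormedAddCommGroup F]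
    [InnerProductSpace ℝ F] {v : F} (hv : ‖v‖ = 1) (ε : ℝ) (u : F) :
    ‖u - inner ℝ v u • v‖ ≤ ‖directionalContraction v ε u‖ := by
  refine le_of_sq_le_sq ?_ (norm_nonneg _)
  rw [norm_sq_directionalContraction hv]
  exact le_add_of_nonneg_right (sq_nonneg _)

/-- No direction is shrunk by more than ε, so errors of size ε‖u‖ are absorbed. -/
theorem mul_norm_le_directionalContraction {F : Type*} [NormedAddCommGroup F]
    [InnerProductSpace ℝ F] {v : F} (hv : ‖v‖ = 1) {ε : ℝ} (hε : 0 ≤ ε) (hε1 : ε ≤ 1) (u : F) :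
    ε * ‖u‖ ≤ ‖directionalContraction v ε u‖ := by
  refine le_of_sq_le_sq ?_ (norm_nonneg _)
  have h1 := norm_sq_directionalContraction hv 1 u
  rw [show directionalContraction v 1 u = u by rw [directionalContraction_apply]; module] at h1
  rw [norm_sq_directionalContraction hv, mul_pow, h1, mul_add, one_mul, mul_pow]
  gcongr
  exact mul_le_of_le_one_left (sq_nonneg _) (pow_le_one₀ hε hε1)

/-! ### Degenerate derivatives force `f` to collapse measure -/

section Covering

variable {X : Type*} [MetricSpace X] {C : ℝ≥0} {Φ : X → EllInfty} {M Q L : ℝ≥0} {k : ℕ}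
  {f : EuclideanSpace ℝ (Fin k) → X} {G : ℕ → EuclideanSpace ℝ (Fin k) → ℝ}

/-- At a density point of a closed set on which the coordinates of `Φ ∘ f` vary slowly in the
direction `v`, the map `f` itself varies slowly in the direction `v`. -/
theorem eventually_edist_le_directionalContraction (hC : 1 ≤ C)
    (hX : ∀ x y : X, ∃ γ : ℝ → X,
      LipschitzOnWith (C * nndist x y) γ (Icc 0 1) ∧ γ 0 = x ∧ γ 1 = y)
    (hM : 1 ≤ M) (hΦ : ∀ γ : ℝ → X, IsRectifiableCurve γ 0 1 →
      (M : ℝ≥0∞)⁻¹ * curveLength γ 0 1 ≤ curveLength (Φ ∘ γ) 0 1)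
    (hQ : LipschitzWith Q Φ) (hG : ∀ i, LipschitzWith (Q * L) (G i))
    {K : Set (EuclideanSpace ℝ (Fin k))} (hK : IsClosed K) (hf : LipschitzOnWith L f K)
    (hGf : ∀ i, ∀ x ∈ K, G i x = Φ (f x) i) {v : EuclideanSpace ℝ (Fin k)} (hv : ‖v‖ = 1)
    {ε : ℝ≥0} (hε : 0 < ε) (hε1 : ε ≤ 1)
    (hgood : ∀ x ∈ K, ∀ i, DifferentiableAt ℝ (G i) x ∧ |fderiv ℝ (G i) x v| ≤ ε)
    {x : EuclideanSpace ℝ (Fin k)} (hxK : x ∈ K) (hx : IsDensityPoint K x) :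
    ∀ᶠ y in 𝓝[K] x, edist (f x) (f y) ≤ ((3 * L + M * (1 + Q * (C * L)) : ℝ≥0) : ℝ≥0∞) *
      edist (directionalContraction v ε x) (directionalContraction v ε y) := by
  have hseg := hx.exists_segment hK.measurableSet (η := ε) (by exact_mod_cast hε)
    (by exact_mod_cast hε1)
  obtain ⟨r₀, hr₀, hseg⟩ := mem_nhdsGT_iff_exists_Ioo_subset.1 hseg
  filter_upwards [self_mem_nhdsWithin,
    mem_nhdsWithin_of_mem_nhds (Metric.ball_mem_nhds x hr₀)] with y hyK hyball
  rcases eq_or_ne y x with rfl | hyx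
  · simp
  set r := ‖y - x‖ with hr
  have hr0 : 0 < r := norm_pos_iff.2 (sub_ne_zero.2 hyx)
  set t : ℝ := inner ℝ v (y - x) with ht
  have htr : |t| ≤ r := by
    have := abs_real_inner_le_norm v (y - x)
    rwa [hv, one_mul] at this
  set w := t • v with hw
  have hwt : ‖w‖ = |t| := by rw [hw, norm_smul, hv, mul_one, Real.norm_eq_abs]
  -- Travel from `x` to `y` via `z` and `z + w`, where `w` is the component of `y - x` along `v`.
  -- Only the middle leg needs weak BLD.
  obtain ⟨z, hzx, hzK, hzwK, hvol⟩ := hseg ⟨hr0, mem_ball_iff_norm.1 hyball⟩ w (hwt ▸ htr)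
  set c : ℝ → X := fun s => f (z + s • w) with hc
  have hline : ∀ s s' : ℝ, edist (z + s • w) (z + s' • w) = ‖w‖₊ * edist s s' := by
    intro s s'
    rw [edist_add_left, edist_nndist, nndist_eq_nnnorm, ← sub_smul, nnnorm_smul, mul_comm,
      ENNReal.coe_mul, edist_nndist, nndist_eq_nnnorm]
  have hlineL : LipschitzWith ‖w‖₊ (fun s : ℝ => z + s • w) := fun s s' => (hline s s').le
  have hclosed : IsClosed {s : ℝ | z + s • w ∈ K} := hK.preimage hlineL.continuous
  have hmain := edist_le_of_weakBLD hC hX hM hΦ hQ hclosed (by simpa using hzK)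
    (by simpa using hzwK) (c := c) (Λ := L * ‖w‖₊) (δ := ε * ‖w‖₊)
    (φ := fun i s => G i (z + s • w))
    (hf.comp hlineL.lipschitzOnWith fun s hs => hs)
    (fun i => ((hG i).comp hlineL).weaken (by
      rw [mul_assoc]
      exact mul_le_mul_right (le_mul_of_one_le_left zero_le hC) Q))
    (fun i s hs => hGf i _ hs)
    (fun i s hs => by
      have hd := (hgood _ hs i).1.hasFDerivAt.comp_hasDerivAt s
        (((hasDerivAt_id s).smul_const w).const_add z)
      have hd' := hd.deriv
      simp only [Function.comp_def, id_eq, one_smul] at hd'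
      rw [hd', hw, map_smul, smul_eq_mul, abs_mul]
      push_cast
      rw [← hw, hwt, mul_comm]
      gcongr
      exact (hgood _ hs i).2)
  have h2 : dist (f z) (f (z + w)) ≤ M * (1 + Q * (C * L)) * (ε * r) := by
    have hbound : edist (f z) (f (z + w)) ≤
        ((M * (ε * ‖w‖₊ + Q * (C * (L * ‖w‖₊)) * ε) : ℝ≥0) : ℝ≥0∞) := by
      simp only [hc, zero_smul, add_zero, one_smul] at hmain
      refine hmain.trans ?_
      push_cast
      gcongr
      simpa using hvol
    rw [edist_nndist, ENNReal.coe_le_coe] at hbound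
    have hb : dist (f z) (f (z + w)) ≤ M * (ε * ‖w‖ + Q * (C * (L * ‖w‖)) * ε) := by
      exact_mod_cast hbound
    refine hb.trans ?_
    have : (M : ℝ) * (ε * ‖w‖ + Q * (C * (L * ‖w‖)) * ε) =
      M * (1 + Q * (C * L)) * (ε * ‖w‖) := by ring
    rw [this]
    gcongr
    exact hwt ▸ htr
  have h1 : dist (f x) (f z) ≤ L * (ε * r) := by
    refine (hf.dist_le_mul x hxK z hzK).trans ?_
    rw [dist_comm, dist_eq_norm]
    gcongr
  have h3 : dist (f (z + w)) (f y) ≤ L * (ε * r + ‖(y - x) - t • v‖) := by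
    refine (hf.dist_le_mul _ hzwK _ hyK).trans ?_
    gcongr
    rw [dist_eq_norm]
    calc ‖z + w - y‖ = ‖(z - x) - ((y - x) - t • v)‖ := by congr 1; rw [hw]; abel
      _ ≤ ‖z - x‖ + ‖(y - x) - t • v‖ := norm_sub_le _ _
      _ ≤ _ := by gcongr
  have hS1 := mul_norm_le_directionalContraction hv ε.2 (by exact_mod_cast hε1) (y - x)
  have hS2 := norm_sub_inner_smul_le_directionalContraction hv ε (y - x)
  rw [← hr] at hS1
  rw [← ht] at hS2
  rw [edist_nndist, edist_nndist, ← ENNReal.coe_mul, ENNReal.coe_le_coe, ← NNReal.coe_le_coe]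
  push_cast
  rw [dist_comm (directionalContraction v ε x), dist_eq_norm, ← map_sub]
  set σ := ‖directionalContraction v ε (y - x)‖
  change (ε : ℝ) * r ≤ σ at hS1
  -- Each error is at most εr or the component orthogonal to `v`, both bounded by σ. The 3 in the
  -- constant counts one `L` for the first leg and two for the last.
  calc dist (f x) (f y) ≤ dist (f x) (f z) + dist (f z) (f (z + w)) + dist (f (z + w)) (f y) :=
        dist_triangle4 _ _ _ _
    _ ≤ L * σ + M * (1 + Q * (C * L)) * σ + L * (σ + σ) := by
        refine add_le_add (add_le_add (h1.trans ?_) (h2.trans ?_)) (h3.trans ?_) <;> gcongr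
    _ = _ := by ring

variable [MeasurableSpace X] [BorelSpace X]

theorem hausdorffMeasure_image_eq_zero_of_volume_eq_zero {N : Set (EuclideanSpace ℝ (Fin k))}
    (hf : LipschitzOnWith L f N) (hN : volume N = 0) : μH[(k : ℝ)] (f '' N) = 0 := by
  have := isAddHaarMeasure_hausdorffMeasure_euclideanSpace k
  have hN' : μH[(k : ℝ)] N = 0 :=
    Measure.absolutelyContinuous_isAddHaarMeasure μH[(k : ℝ)] volume hN
  have h := hf.hausdorffMeasure_image_le (d := k) (by positivity)
  rw [hN', mul_zero] at h
  exact nonpos_iff_eq_zero.1 h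

/-- Quantitative form of the collapse of `f` on a compact set on which `Φ ∘ f` varies slowly in a
fixed direction. -/
theorem hausdorffMeasure_image_le_of_isCompact (hC : 1 ≤ C)
    (hX : ∀ x y : X, ∃ γ : ℝ → X,
      LipschitzOnWith (C * nndist x y) γ (Icc 0 1) ∧ γ 0 = x ∧ γ 1 = y)
    (hM : 1 ≤ M) (hΦ : ∀ γ : ℝ → X, IsRectifiableCurve γ 0 1 →
      (M : ℝ≥0∞)⁻¹ * curveLength γ 0 1 ≤ curveLength (Φ ∘ γ) 0 1)
    (hQ : LipschitzWith Q Φ) (hG : ∀ i, LipschitzWith (Q * L) (G i))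
    {K : Set (EuclideanSpace ℝ (Fin k))} (hK : IsCompact K) (hf : LipschitzOnWith L f K)
    (hGf : ∀ i, ∀ x ∈ K, G i x = Φ (f x) i) {v : EuclideanSpace ℝ (Fin k)} (hv : ‖v‖ = 1)
    {ε : ℝ≥0} (hε : 0 < ε) (hε1 : ε ≤ 1)
    (hgood : ∀ x ∈ K, ∀ i, DifferentiableAt ℝ (G i) x ∧ |fderiv ℝ (G i) x v| ≤ ε) :
    μH[(k : ℝ)] (f '' K) ≤ ((3 * L + M * (1 + Q * (C * L)) : ℝ≥0) : ℝ≥0∞) ^ (k : ℝ) *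
      (ε * μH[(k : ℝ)] K) := by
  have := isAddHaarMeasure_hausdorffMeasure_euclideanSpace k
  set D := {x ∈ K | IsDensityPoint K x} with hD
  have hDK : D ⊆ K := fun x hx => hx.1
  have hnull : volume (K \ D) = 0 := by
    have h := ae_isDensityPoint K
    rw [ae_restrict_iff' hK.measurableSet, ae_iff] at h
    refine measure_mono_null ?_ h
    intro x hx hcon
    exact hx.2 ⟨hx.1, hcon hx.1⟩
  have hD' : μH[(k : ℝ)] (f '' D) ≤ ((3 * L + M * (1 + Q * (C * L)) : ℝ≥0) : ℝ≥0∞) ^ (k : ℝ) *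
      (ε * μH[(k : ℝ)] D) := by
    refine hausdorffMeasure_image_le_of_eventually_edist_le (by positivity)
      (S := directionalContraction v ε) (fun x hx => ?_) (fun A => ?_)
    · exact (eventually_edist_le_directionalContraction hC hX hM hΦ hQ hG hK.isClosed hf hGf hv hε
        hε1 hgood hx.1 hx.2).filter_mono (nhdsWithin_mono _ hDK)
    -- The decisive factor ε is the determinant of the contraction.
    · rw [Measure.addHaar_image_linearMap, det_directionalContraction hv]
      simp
  calc μH[(k : ℝ)] (f '' K) ≤ μH[(k : ℝ)] (f '' D) + μH[(k : ℝ)] (f '' (K \ D)) := by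
        rw [← union_sdiff_cancel hDK, image_union]
        simpa only [union_sdiff_cancel hDK] using measure_union_le _ _
    _ = μH[(k : ℝ)] (f '' D) := by
        rw [hausdorffMeasure_image_eq_zero_of_volume_eq_zero (hf.mono sdiff_subset) hnull, add_zero]
    _ ≤ _ := hD'.trans (by gcongr)

/-- Inner regularity reduces to compact subsets. The image of the small remainder is controlled by
the Lipschitz constant of `f`. -/
theorem hausdorffMeasure_image_le_of_measurableSet (hC : 1 ≤ C)
    (hX : ∀ x y : X, ∃ γ : ℝ → X,
      LipschitzOnWith (C * nndist x y) γ (Icc 0 1) ∧ γ 0 = x ∧ γ 1 = y)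
    (hM : 1 ≤ M) (hΦ : ∀ γ : ℝ → X, IsRectifiableCurve γ 0 1 →
      (M : ℝ≥0∞)⁻¹ * curveLength γ 0 1 ≤ curveLength (Φ ∘ γ) 0 1)
    (hQ : LipschitzWith Q Φ) (hG : ∀ i, LipschitzWith (Q * L) (G i))
    {A : Set (EuclideanSpace ℝ (Fin k))} (hA : MeasurableSet A) (hA' : μH[(k : ℝ)] A ≠ ∞)
    (hf : LipschitzOnWith L f A)
    (hGf : ∀ i, ∀ x ∈ A, G i x = Φ (f x) i) {v : EuclideanSpace ℝ (Fin k)} (hv : ‖v‖ = 1)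
    {ε : ℝ≥0} (hε : 0 < ε) (hε1 : ε ≤ 1)
    (hgood : ∀ x ∈ A, ∀ i, DifferentiableAt ℝ (G i) x ∧ |fderiv ℝ (G i) x v| ≤ ε) :
    μH[(k : ℝ)] (f '' A) ≤ ((3 * L + M * (1 + Q * (C * L)) : ℝ≥0) : ℝ≥0∞) ^ (k : ℝ) *
      (ε * μH[(k : ℝ)] A) := by
  have := isAddHaarMeasure_hausdorffMeasure_euclideanSpace k
  refine ENNReal.le_of_forall_pos_le_add fun τ hτ _ => ?_
  -- The `+ 1` keeps the divisor nonzero when `L = 0`.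
  have hδ : (τ : ℝ≥0∞) / (L ^ k + 1 : ℝ≥0) ≠ 0 := by
    simp [ENNReal.div_eq_zero_iff, hτ.ne']
  obtain ⟨K, hKA, hK, hAK⟩ := hA.exists_isCompact_sdiff_lt hA' hδ
  have h1 := hausdorffMeasure_image_le_of_isCompact hC hX hM hΦ hQ hG hK (hf.mono hKA)
    (fun i x hx => hGf i x (hKA hx)) hv hε hε1 (fun x hx => hgood x (hKA hx))
  have h2 := (hf.mono (sdiff_subset : A \ K ⊆ A)).hausdorffMeasure_image_le (d := k)
    (by positivity)
  calc μH[(k : ℝ)] (f '' A) ≤ μH[(k : ℝ)] (f '' K) + μH[(k : ℝ)] (f '' (A \ K)) := by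
        rw [← union_sdiff_cancel hKA, image_union]
        simpa only [union_sdiff_cancel hKA] using measure_union_le _ _
    _ ≤ _ := by
        refine add_le_add (h1.trans (by gcongr)) (h2.trans ?_)
        rw [ENNReal.rpow_natCast]
        calc (L : ℝ≥0∞) ^ k * μH[(k : ℝ)] (A \ K)
            ≤ (L ^ k + 1 : ℝ≥0) * ((τ : ℝ≥0∞) / (L ^ k + 1 : ℝ≥0)) := by
              gcongr
              push_cast
              exact le_self_add
          _ ≤ τ := ENNReal.mul_div_le

/-- If the derivative of `Φ ∘ f` has a nontrivial kernel almost everywhere on `E`, then `f` maps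
`E` to a set of zero Hausdorff measure. -/
theorem hausdorffMeasure_image_eq_zero_of_ker (hC : 1 ≤ C)
    (hX : ∀ x y : X, ∃ γ : ℝ → X,
      LipschitzOnWith (C * nndist x y) γ (Icc 0 1) ∧ γ 0 = x ∧ γ 1 = y)
    (hM : 1 ≤ M) (hΦ : ∀ γ : ℝ → X, IsRectifiableCurve γ 0 1 →
      (M : ℝ≥0∞)⁻¹ * curveLength γ 0 1 ≤ curveLength (Φ ∘ γ) 0 1)
    (hQ : LipschitzWith Q Φ) (hG : ∀ i, LipschitzWith (Q * L) (G i))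
    {E : Set (EuclideanSpace ℝ (Fin k))} (hE : NullMeasurableSet E volume)
    (hf : LipschitzOnWith L f E) (hGf : ∀ i, ∀ x ∈ E, G i x = Φ (f x) i)
    (hker : ∀ᵐ x, x ∈ E → ∃ w : EuclideanSpace ℝ (Fin k), w ≠ 0 ∧ ∀ i, fderiv ℝ (G i) x w = 0) :
    μH[(k : ℝ)] (f '' E) = 0 := by
  have hHaar := isAddHaarMeasure_hausdorffMeasure_euclideanSpace k
  have hdiff : ∀ᵐ x, ∀ i, DifferentiableAt ℝ (G i) x :=
    ae_all_iff.2 fun i => (hG i).ae_differentiableAt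
  have hae : ∀ᵐ x, x ∈ E → (∀ i, DifferentiableAt ℝ (G i) x) ∧
      ∃ w : EuclideanSpace ℝ (Fin k), ‖w‖ = 1 ∧ ∀ i, fderiv ℝ (G i) x w = 0 := by
    filter_upwards [hker, hdiff] with x hx hx' hxE
    obtain ⟨w, hw, hw'⟩ := hx hxE
    refine ⟨hx', ‖w‖⁻¹ • w, ?_, fun i => by rw [map_smul, hw' i, smul_zero]⟩
    rw [norm_smul, norm_inv, norm_norm, inv_mul_cancel₀ (norm_ne_zero_iff.2 hw)]
  rw [ae_iff] at hae
  -- The sphere is empty when k = 0. Then no unit kernel vector exists, so `E` itself is null.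
  rcases isEmpty_or_nonempty (Metric.sphere (0 : EuclideanSpace ℝ (Fin k)) 1) with hS | hS
  · refine hausdorffMeasure_image_eq_zero_of_volume_eq_zero hf (measure_mono_null ?_ hae)
    intro x hx hcon
    obtain ⟨-, w, hw, -⟩ := hcon hx
    exact hS.elim ⟨w, by simpa using hw⟩
  have hbdd : ∀ A : Set (EuclideanSpace ℝ (Fin k)), A ⊆ E → MeasurableSet A →
      μH[(k : ℝ)] A ≠ ∞ → μH[(k : ℝ)] (f '' A) = 0 := by
    intro A hAE hA hAfin
    set c := ((3 * L + M * (1 + Q * (C * L)) : ℝ≥0) : ℝ≥0∞) ^ (k : ℝ) with hc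
    have hctop : c ≠ ∞ := by rw [hc, ENNReal.rpow_natCast]; exact ENNReal.pow_ne_top ENNReal.coe_ne_top
    have hest : ∀ ε : ℝ≥0, 0 < ε → ε ≤ 1 → μH[(k : ℝ)] (f '' A) ≤ c * (ε * μH[(k : ℝ)] A) := by
      intro ε hε hε1
      set v : ℕ → EuclideanSpace ℝ (Fin k) := fun j =>
        (TopologicalSpace.denseSeq (Metric.sphere (0 : EuclideanSpace ℝ (Fin k)) 1) j).1 with hv
      have hv1 : ∀ j, ‖v j‖ = 1 := fun j =>
        mem_sphere_zero_iff_norm.1 (TopologicalSpace.denseSeq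
          (Metric.sphere (0 : EuclideanSpace ℝ (Fin k)) 1) j).2
      -- Kernel directions vary with the point. `B j` collects the points where the fixed direction
      -- `v j` is ε-close to degenerate for every coordinate.
      set B : ℕ → Set (EuclideanSpace ℝ (Fin k)) := fun j =>
        A ∩ ⋂ i, ({x | DifferentiableAt ℝ (G i) x} ∩ {x | |fderiv ℝ (G i) x (v j)| ≤ ε}) with hB
      have hBm : ∀ j, MeasurableSet (B j) := fun j => by
        refine hA.inter (MeasurableSet.iInter fun i => (measurableSet_of_differentiableAt ℝ _).inter ?_)
        exact measurableSet_le (measurable_fderiv_apply_const ℝ (G i) (v j)).abs measurable_const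
      have hBA : ∀ j, disjointed B j ⊆ A := fun j =>
        (disjointed_subset B j).trans inter_subset_left
      have hnull : volume (A \ ⋃ j, disjointed B j) = 0 := by
        refine measure_mono_null ?_ hae
        rintro x ⟨hxA, hxB⟩ hcon
        obtain ⟨hd, w, hw, hw'⟩ := hcon (hAE hxA)
        refine hxB ?_
        rw [iUnion_disjointed]
        -- Every derivative has norm at most `Q * L`, so moving the kernel vector by this radius
        -- changes all slopes by at most ε.
        have hpos : 0 < (ε : ℝ) / (Q * L + 1) := by positivity
        obtain ⟨_, ⟨j, rfl⟩, hj⟩ := Metric.dense_iff.1 (TopologicalSpace.denseRange_denseSeq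
          (Metric.sphere (0 : EuclideanSpace ℝ (Fin k)) 1)) ⟨w, by simpa using hw⟩ _ hpos
          |>.imp fun a h => And.symm h
        refine mem_iUnion.2 ⟨j, hxA, mem_iInter.2 fun i => ⟨hd i, ?_⟩⟩
        have hj' : ‖v j - w‖ < ε / (Q * L + 1) := by
          rw [Metric.mem_ball, Subtype.dist_eq, dist_eq_norm] at hj
          exact hj
        have hop : ‖fderiv ℝ (G i) x‖ ≤ Q * L := by
          simpa using norm_fderiv_le_of_lipschitz ℝ (hG i) (x₀ := x)
        calc |fderiv ℝ (G i) x (v j)| = ‖fderiv ℝ (G i) x (v j - w)‖ := by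
              rw [map_sub, hw' i, sub_zero, Real.norm_eq_abs]
          _ ≤ (Q * L + 1) * (ε / (Q * L + 1)) :=
              (ContinuousLinearMap.le_opNorm _ _).trans
                (mul_le_mul (by linarith) hj'.le (norm_nonneg _) (by positivity))
          _ = ε := by field_simp
      have hcov : f '' A ⊆ (⋃ j, f '' disjointed B j) ∪ f '' (A \ ⋃ j, disjointed B j) := by
        rw [← image_iUnion, ← image_union, union_sdiff_self]
        exact image_mono subset_union_right
      calc μH[(k : ℝ)] (f '' A)
          ≤ μH[(k : ℝ)] (⋃ j, f '' disjointed B j) +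
              μH[(k : ℝ)] (f '' (A \ ⋃ j, disjointed B j)) :=
            (measure_mono hcov).trans (measure_union_le _ _)
        _ = μH[(k : ℝ)] (⋃ j, f '' disjointed B j) := by
            rw [hausdorffMeasure_image_eq_zero_of_volume_eq_zero
              (hf.mono (sdiff_subset.trans hAE)) hnull, add_zero]
        _ ≤ ∑' j, μH[(k : ℝ)] (f '' disjointed B j) := measure_iUnion_le _
        _ ≤ ∑' j, c * (ε * μH[(k : ℝ)] (disjointed B j)) := by
            refine ENNReal.tsum_le_tsum fun j => ?_
            refine hausdorffMeasure_image_le_of_measurableSet hC hX hM hΦ hQ hG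
              (MeasurableSet.disjointed hBm j) (measure_ne_top_of_subset (hBA j) hAfin)
              (hf.mono ((hBA j).trans hAE)) (fun i x hx => hGf i x (hAE (hBA j hx))) (hv1 j) hε hε1
              fun x hx i => ?_
            exact mem_iInter.1 (disjointed_subset B j hx).2 i
        _ = c * (ε * μH[(k : ℝ)] (⋃ j, disjointed B j)) := by
            rw [ENNReal.tsum_mul_left, ENNReal.tsum_mul_left,
              measure_iUnion (disjoint_disjointed B) (MeasurableSet.disjointed hBm)]
        _ ≤ _ := by
            gcongr
            exact iUnion_subset hBA
    -- The constant `c` does not depend on ε, so ε → 0 forces measure zero.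
    have htend : Tendsto (fun ε : ℝ≥0 => c * ((ε : ℝ≥0∞) * μH[(k : ℝ)] A)) (𝓝[>] 0) (𝓝 0) := by
      have h0 : Tendsto (fun ε : ℝ≥0 => (ε : ℝ≥0∞)) (𝓝[>] 0) (𝓝 0) := by
        have := (ENNReal.continuous_coe.tendsto (0 : ℝ≥0)).mono_left
          (nhdsWithin_le_nhds (s := Ioi 0))
        simpa using this
      have h1 := ENNReal.Tendsto.mul_const h0 (Or.inr hAfin)
      have h2 := ENNReal.Tendsto.const_mul h1 (Or.inr hctop)
      simpa using h2
    refine nonpos_iff_eq_zero.1 (ge_of_tendsto htend ?_)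
    filter_upwards [self_mem_nhdsWithin, mem_nhdsWithin_of_mem_nhds (Iio_mem_nhds one_pos)]
      with ε hε hε1 using hest ε hε hε1.le
  obtain ⟨E', hE'E, hE', hE'ae⟩ := hE.exists_measurable_subset_ae_eq
  have hcov : f '' E ⊆ (⋃ n : ℕ, f '' (E' ∩ Metric.ball 0 n)) ∪ f '' (E \ E') := by
    rw [← image_iUnion, ← inter_iUnion, Metric.iUnion_ball_nat, inter_univ, ← image_union,
      union_sdiff_self]
    exact image_mono subset_union_right
  refine measure_mono_null hcov (measure_union_null (measure_iUnion_null fun n => ?_) ?_)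
  · refine hbdd _ (inter_subset_left.trans hE'E) (hE'.inter measurableSet_ball) ?_
    exact measure_ne_top_of_subset inter_subset_right measure_ball_lt_top.ne
  · exact hausdorffMeasure_image_eq_zero_of_volume_eq_zero (hf.mono sdiff_subset)
      (ae_le_set.1 hE'ae.symm.le)

end Covering

/-! ### Null images force degenerate derivatives -/

/-- If countably many linear maps on a finite-dimensional space have no common kernel, then neither
do finitely many of them. -/
theorem exists_nat_forall_lt_eq_zero {F : Type*} [AddCommGroup F] [Module ℝ F]
    [FiniteDimensional ℝ F] (D : ℕ → F →ₗ[ℝ] ℝ) (hD : ∀ w, (∀ i, D i w = 0) → w = 0) :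
    ∃ n : ℕ, ∀ w, (∀ i < n, D i w = 0) → w = 0 := by
  set W : ℕ →o (Submodule ℝ F)ᵒᵈ :=
    { toFun := fun n => OrderDual.toDual (⨅ i, ⨅ _ : i < n, LinearMap.ker (D i))
      monotone' := fun m n hmn => by
        rw [OrderDual.toDual_le_toDual]
        exact biInf_mono fun i hi => lt_of_lt_of_le hi hmn } with hW
  have hmem : ∀ n w, w ∈ OrderDual.ofDual (W n) ↔ ∀ i < n, D i w = 0 := by
    intro n w
    simp [hW, Submodule.mem_iInf]
  -- The common kernels of the first n maps form a decreasing chain of subspaces, which stabilises.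
  obtain ⟨n, hn⟩ := monotone_stabilizes_iff_artinian.2 (inferInstance : IsArtinian ℝ F) W
  refine ⟨n, fun w hw => hD w fun i => ?_⟩
  have h1 : w ∈ OrderDual.ofDual (W (max n (i + 1))) := by
    rw [← hn _ (le_max_left _ _)]
    exact (hmem n w).2 hw
  exact (hmem _ w).1 h1 i (lt_of_lt_of_le i.lt_succ_self (le_max_right _ _))

/-- A map into a finite-dimensional space with injective derivative on `s` cannot collapse `s` to a
set of zero Hausdorff measure, unless `s` itself has zero measure. -/
theorem hausdorffMeasure_eq_zero_of_injective_fderiv {F F' : Type*} [NormedAddCommGroup F]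
    [NormedSpace ℝ F] [FiniteDimensional ℝ F] [MeasurableSpace F] [BorelSpace F]
    [NormedAddCommGroup F'] [NormedSpace ℝ F'] [SecondCountableTopology F'] [MeasurableSpace F']
    [BorelSpace F'] {h : F → F'} {h' : F → F →L[ℝ] F'} {s : Set F}
    (hd : ∀ x ∈ s, HasFDerivWithinAt h (h' x) s x) (hinj : ∀ x ∈ s, Function.Injective (h' x))
    {d : ℝ} (hd0 : 0 ≤ d) (h0 : μH[d] (h '' s) = 0) : μH[d] s = 0 := by
  rcases s.eq_empty_or_nonempty with rfl | hne
  · simp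
  have hanti : ∀ A : F →L[ℝ] F', Function.Injective A → ∃ K : ℝ≥0, 0 < K ∧ AntilipschitzWith K A :=
    fun A hA => LinearMap.exists_antilipschitzWith A.toLinearMap (LinearMap.ker_eq_bot.2 hA)
  choose! κ hκ0 hκ using hanti
  classical
  obtain ⟨t, A, -, -, hst, happ, hA⟩ := exists_partition_approximatesLinearOn_of_hasFDerivWithinAt
    -- An error of half the lower bound `(κ A)⁻¹` of `A` can be absorbed, leaving `h` bounded below
    -- with constant `2 * κ A`.
    h s h' hd (fun A => if Function.Injective A then (κ A)⁻¹ / 2 else 1) (fun A => by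
      split_ifs with hA
      · exact (half_pos (inv_pos.2 (hκ0 A hA))).ne'
      · exact one_ne_zero)
  have hcov : s ⊆ ⋃ n, s ∩ t n := by rw [← inter_iUnion]; exact subset_inter subset_rfl hst
  refine measure_mono_null hcov (measure_iUnion_null fun n => ?_)
  obtain ⟨y, hy, hAy⟩ := hA hne n
  have hAinj : Function.Injective (A n) := hAy ▸ hinj y hy
  have hκn := hκ0 _ hAinj
  have happn := happ n
  simp only [hAinj, if_true] at happn
  have hlow : ∀ x ∈ s ∩ t n, ∀ y ∈ s ∩ t n,
      edist (id x) (id y) ≤ (2 * κ (A n) : ℝ≥0) * edist (h x) (h y) := by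
    intro x hx y hy
    have h1 := happn x hx y hy
    have h2 := (hκ _ hAinj).le_mul_dist x y
    rw [dist_eq_norm, dist_eq_norm, ← map_sub] at h2
    have h3 : ‖(A n) (x - y)‖ ≤ ‖h x - h y‖ + ‖h x - h y - (A n) (x - y)‖ := by
      have := norm_sub_le (h x - h y) (h x - h y - (A n) (x - y))
      rwa [sub_sub_cancel] at this
    push_cast at h1
    have hκr : (0 : ℝ) < κ (A n) := hκn
    have h4 : ‖x - y‖ ≤ κ (A n) * ‖h x - h y‖ + ‖x - y‖ / 2 := by
      calc ‖x - y‖ ≤ κ (A n) * ‖(A n) (x - y)‖ := h2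
        _ ≤ κ (A n) * (‖h x - h y‖ + (κ (A n) : ℝ)⁻¹ / 2 * ‖x - y‖) := by
            gcongr; exact h3.trans (by gcongr)
        _ = _ := by field_simp
    rw [edist_nndist, edist_nndist, ← ENNReal.coe_mul, ENNReal.coe_le_coe, ← NNReal.coe_le_coe]
    push_cast
    rw [id, id, dist_eq_norm, dist_eq_norm]
    linarith
  have hle := hausdorffMeasure_image_le_of_edist_le hlow hd0
  rw [image_id, measure_mono_null (image_mono inter_subset_left) h0, mul_zero] at hle
  exact nonpos_iff_eq_zero.1 hle

/-- Passing to finitely many coordinates keeps the image null and lands in a finite-dimensional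
target, where coordinatewise derivatives assemble to a Fréchet derivative. -/
theorem edist_apply_le_edist {ι : Type*} [Fintype ι] (e : ι → ℕ) (p q : EllInfty) :
    edist (fun i => p (e i)) (fun i => q (e i)) ≤ edist p q := by
  rw [edist_dist, edist_dist]
  refine ENNReal.ofReal_le_ofReal ((dist_pi_le_iff dist_nonneg).2 fun i => ?_)
  rw [dist_eq_norm, dist_eq_norm]
  exact lp.norm_apply_le_norm (by simp) (p - q) (e i)

/-- If `g` maps `E ⊆ ℝ^k` to a set of zero `k`-dimensional Hausdorff measure, then the derivatives of
its coordinates have a common kernel almost everywhere on `E`. -/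
theorem ae_exists_ker_of_hausdorffMeasure_image_eq_zero {k : ℕ}
    {g : EuclideanSpace ℝ (Fin k) → EllInfty} {G : ℕ → EuclideanSpace ℝ (Fin k) → ℝ} {L : ℝ≥0}
    (hG : ∀ i, LipschitzWith L (G i)) {E : Set (EuclideanSpace ℝ (Fin k))}
    (hGg : ∀ i, ∀ x ∈ E, G i x = g x i) (h0 : μH[(k : ℝ)] (g '' E) = 0) :
    ∀ᵐ x, x ∈ E → ∃ w : EuclideanSpace ℝ (Fin k), w ≠ 0 ∧ ∀ i, fderiv ℝ (G i) x w = 0 := by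
  have := isAddHaarMeasure_hausdorffMeasure_euclideanSpace k
  have hdiff : ∀ᵐ x, ∀ i, DifferentiableAt ℝ (G i) x :=
    ae_all_iff.2 fun i => (hG i).ae_differentiableAt
  set s : ℕ → Set (EuclideanSpace ℝ (Fin k)) := fun n =>
    {x ∈ E | (∀ i, DifferentiableAt ℝ (G i) x) ∧
      ∀ w, (∀ i < n, fderiv ℝ (G i) x w = 0) → w = 0} with hs
  have hsn : ∀ n, volume (s n) = 0 := by
    intro n
    refine Measure.absolutelyContinuous_isAddHaarMeasure volume μH[(k : ℝ)] ?_
    refine hausdorffMeasure_eq_zero_of_injective_fderiv (F' := Fin n → ℝ)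
      (h := fun x i => G i x)
      (h' := fun x => ContinuousLinearMap.pi fun i : Fin n => fderiv ℝ (G i) x)
      (fun x hx => ?_) (fun x hx => ?_) (by positivity) ?_
    · exact hasFDerivWithinAt_pi.2 fun i => (hx.2.1 i).hasFDerivAt.hasFDerivWithinAt
    · refine (injective_iff_map_eq_zero _).2 fun w hw => hx.2.2 w fun i hi => ?_
      exact congrFun hw ⟨i, hi⟩
    · have hle := hausdorffMeasure_image_le_of_edist_le (A := s n) (C := 1) (d := k)
        (f := fun x (i : Fin n) => G i x) (S := g) (fun x hx y hy => by
          have he : ∀ x ∈ E, (fun i : Fin n => G i x) = fun i : Fin n => g x i :=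
            fun x hx => funext fun i => hGg i x hx
          rw [he x hx.1, he y hy.1, ENNReal.coe_one, one_mul]
          exact edist_apply_le_edist _ _ _) (by positivity)
      rw [measure_mono_null (image_mono fun x hx => hx.1) h0, mul_zero] at hle
      exact nonpos_iff_eq_zero.1 hle
  have hae : ∀ᵐ x, ∀ n, x ∉ s n :=
    ae_all_iff.2 fun n => measure_eq_zero_iff_ae_notMem.1 (hsn n)
  filter_upwards [hdiff, hae] with x hxd hxs hxE
  by_contra! hcon
  obtain ⟨n, hn⟩ := exists_nat_forall_lt_eq_zero
    (fun i => (fderiv ℝ (G i) x).toLinearMap) (fun w hw => by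
      by_contra hw0
      obtain ⟨i, hi⟩ := hcon w hw0
      exact hi (hw i))
  exact hxs n ⟨hxE, hxd, hn⟩

/-! ### Rank, approximate derivatives, and the equivalence -/

/-- Rank–nullity on the k-dimensional domain, so infinitely many rows do no harm. -/
theorem Matrix.rank_lt_iff_exists_mulVec_eq_zero {m : Type*} {k : ℕ} (A : Matrix m (Fin k) ℝ) :
    A.rank < k ↔ ∃ w : Fin k → ℝ, w ≠ 0 ∧ A.mulVec w = 0 := by
  have hrn := LinearMap.finrank_range_add_finrank_ker A.mulVecLin
  rw [Module.finrank_fin_fun] at hrn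
  have hrank : A.rank = Module.finrank ℝ (LinearMap.range A.mulVecLin) := rfl
  constructor
  · intro h
    have hker : LinearMap.ker A.mulVecLin ≠ ⊥ := by
      intro hbot
      rw [hbot, finrank_bot] at hrn
      omega
    obtain ⟨w, hw, hw0⟩ := Submodule.exists_mem_ne_zero_of_ne_bot hker
    exact ⟨w, hw0, hw⟩
  · rintro ⟨w, hw0, hw⟩
    have hpos : 0 < Module.finrank ℝ (LinearMap.ker A.mulVecLin) := by
      refine Module.finrank_pos_iff_exists_ne_zero.2 ⟨⟨w, hw⟩, fun h => hw0 ?_⟩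
      exact congrArg Subtype.val h
    omega

theorem EuclideanSpace.inner_toLp_eq_dotProduct {k : ℕ} (a : Fin k → ℝ)
    (w : EuclideanSpace ℝ (Fin k)) : inner ℝ (WithLp.toLp 2 a) w = a ⬝ᵥ w.ofLp := by
  rw [EuclideanSpace.inner_eq_star_dotProduct, dotProduct_comm]
  simp

/-- Approximate differentiability with degenerate derivative, expressed through Lipschitz extensions
of the coordinates. -/
theorem ae_exists_hasApproxDerivAt_rank_lt_iff {k : ℕ}
    {g : EuclideanSpace ℝ (Fin k) → EllInfty} {G : ℕ → EuclideanSpace ℝ (Fin k) → ℝ} {L : ℝ≥0}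
    (hG : ∀ i, LipschitzWith L (G i)) {E : Set (EuclideanSpace ℝ (Fin k))}
    (hE : NullMeasurableSet E volume) (hGg : ∀ i, ∀ x ∈ E, G i x = g x i) :
    (∀ᵐ x, x ∈ E → ∃ A : Matrix ℕ (Fin k) ℝ, HasApproxDerivAt g A E x ∧ A.rank < k) ↔
      ∀ᵐ x, x ∈ E → ∃ w : EuclideanSpace ℝ (Fin k), w ≠ 0 ∧ ∀ i, fderiv ℝ (G i) x w = 0 := by
  have hdiff : ∀ᵐ x, ∀ i, DifferentiableAt ℝ (G i) x :=
    ae_all_iff.2 fun i => (hG i).ae_differentiableAt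
  constructor
  · intro h
    filter_upwards [h, hdiff] with x hx hxd hxE
    obtain ⟨A, hA, hrank⟩ := hx hxE
    obtain ⟨w, hw0, hw⟩ := A.rank_lt_iff_exists_mulVec_eq_zero.1 hrank
    refine ⟨WithLp.toLp 2 w, by simpa using hw0, fun i => ?_⟩
    obtain ⟨S, hSE, hS, hSx, hgrad⟩ := hA i
    have h1 : HasFDerivWithinAt (G i) (InnerProductSpace.toDual ℝ _ (WithLp.toLp 2 (A i))) S x :=
      (hasGradientWithinAt_iff_hasFDerivWithinAt.1 hgrad).congr
        (fun y hy => hGg i y (hSE hy)) (hGg i x hxE)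
    -- The set `S` may depend on `i`. Uniqueness at its density point `x` identifies each row of `A`
    -- with the derivative of `G i`.
    rw [← hSx.hasFDerivWithinAt_unique hS h1 (hxd i).hasFDerivAt.hasFDerivWithinAt,
      InnerProductSpace.toDual_apply_apply, EuclideanSpace.inner_toLp_eq_dotProduct]
    exact congrFun hw i
  · intro h
    have hdens := ae_isDensityPoint E
    rw [ae_restrict_iff'₀ hE] at hdens
    filter_upwards [h, hdiff, hdens] with x hx hxd hxE' hxE
    obtain ⟨w, hw0, hw⟩ := hx hxE
    refine ⟨fun i => (gradient (G i) x).ofLp, fun i => ⟨E, subset_rfl, hE, hxE' hxE, ?_⟩, ?_⟩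
    · exact hasGradientWithinAt_iff_hasFDerivWithinAt.2
        ((hasGradientAt_iff_hasFDerivAt.1 (hxd i).hasGradientAt).hasFDerivWithinAt.congr
          (fun y hy => (hGg i y hy).symm) (hGg i x hxE).symm)
    · refine (Matrix.rank_lt_iff_exists_mulVec_eq_zero _).2 ⟨w.ofLp, by simpa using hw0, ?_⟩
      funext i
      have := hw i
      rw [← (InnerProductSpace.toDual ℝ _).apply_symm_apply (fderiv ℝ (G i) x),
        InnerProductSpace.toDual_apply_apply] at this
      exact (EuclideanSpace.inner_toLp_eq_dotProduct _ w).symm.trans this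

theorem theorem1p2 {X : Type*} [MetricSpace X] [CompleteSpace X]
    [MeasurableSpace X] [BorelSpace X] (hX : IsQuasiconvexSpace X)
    (Φ : X → EllInfty) (hΦ : IsWeakBLD Φ) (k : ℕ)
    (E : Set (EuclideanSpace ℝ (Fin k))) (hE : NullMeasurableSet E volume)
    (f : EuclideanSpace ℝ (Fin k) → X) (hf : ∃ L : ℝ≥0, LipschitzOnWith L f E) :
    List.TFAE [
      μH[(k : ℝ)] (f '' E) = 0,
      μH[(k : ℝ)] (Φ '' (f '' E)) = 0,
      ∀ᵐ x ∂(volume : Measure (EuclideanSpace ℝ (Fin k))), x ∈ E →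
        ∃ A : Matrix ℕ (Fin k) ℝ, HasApproxDerivAt (Φ ∘ f) A E x ∧ A.rank < k] := by
  obtain ⟨L, hL⟩ := hf
  obtain ⟨Q, hQ⟩ := hΦ.exists_lipschitzWith hX
  obtain ⟨C, hC, hcurves⟩ := hX.exists_lipschitz_curves
  obtain ⟨M, hM, hBLD⟩ := hΦ
  have hcoord : ∀ i : ℕ, LipschitzOnWith (Q * L) (fun x => (Φ ∘ f) x i) E := fun i =>
    LipschitzOnWith.of_dist_le_mul fun x hx y hy => by
      have h1 := (hQ.lipschitzOnWith.comp hL (mapsTo_univ f E)).dist_le_mul x hx y hy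
      refine le_trans ?_ h1
      rw [dist_eq_norm, dist_eq_norm]
      exact lp.norm_apply_le_norm (by simp) ((Φ ∘ f) x - (Φ ∘ f) y) i
  -- Real-valued Lipschitz functions extend with the same constant, which gives one bound uniform in
  -- `i`.
  choose G hG hGf using fun i => (hcoord i).extend_real
  have hGeq : ∀ i, ∀ x ∈ E, G i x = (Φ ∘ f) x i := fun i x hx => (hGf i hx).symm
  tfae_have 1 → 2 := by
    intro h
    have hle := hQ.hausdorffMeasure_image_le (d := k) (by positivity) (f '' E)
    rw [h, mul_zero] at hle
    exact nonpos_iff_eq_zero.1 hle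
  tfae_have 2 → 3 := by
    intro h
    rw [← image_comp] at h
    exact (ae_exists_hasApproxDerivAt_rank_lt_iff hG hE hGeq).2
      (ae_exists_ker_of_hausdorffMeasure_image_eq_zero hG hGeq h)
  tfae_have 3 → 1 := fun h =>
    hausdorffMeasure_image_eq_zero_of_ker hC hcurves hM
      (fun γ hγ => (hBLD 0 1 γ zero_le_one hγ).1) hQ hG hE hL hGeq
      ((ae_exists_hasApproxDerivAt_rank_lt_iff hG hE hGeq).1 h)
  tfae_finish
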